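/- For integers $n, k, \lambda \ge 0$, a family $\mathcal F$ of subsets of $[n]=\{1,\dots,n\}$ is called $k$-almost $\lambda$-Fisher if for every $F\in\mathcal F$ there are at most $k$ sets $F'\in\mathcal F\setminus\{F\}$ with $|F\cap F'|\neq\lambda$. Let $f(n,k,\lambda)$ be the maximum size of a $k$-almost $\lambda$-Fisher family $\mathcal F\subseteq 2^{[n]}$. **Theorem 1.6.** There is an $n_0$ such that for all $n\ge n_0$ and all integers $0\le\lambda\le n$: (i) $f(n,2,\lambda)\le 2n-2$; (ii) $f(n,2,\lambda)\le\frac13\left(5n+4\min\left\{\lambda,\frac{n-\lambda}{3}\right\}+7\right)$; (iii) $f(n,2,\lambda)\le\frac32 n+3\lambda+\frac12\sqrt{\lambda n}+90$. In particular, for every sequence of non-negative integers $\lambda=\lambda(n)$ with $\lambda(n)=o(n)$, we have $f(n,2,\lambda(n))\le\left(\frac32+o(1)\right)n$ as $n\to\infty$. Moreover, the bound in (i) is tight: for every sufficiently large $n$ for which a Hadamard matrix of order $n$ (an $n \times n$ matrix with entries $\pm1$ and pairwise orthogonal columns) exists, $4$ divides $n$ and $f(n,2,n/4)=2n-2$;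 and $f(n,2,n/4)=2n-2$ holds for infinitely many multiples $n$ of $4$. -/

import Mathlib

/-- A family `𝓕` of subsets of an `n`-element ground set is `k`-almost `l`-Fisher if for every
`F ∈ 𝓕` there are at most `k` other sets `F' ∈ 𝓕` with `|F ∩ F'| ≠ l`. -/
def IsAlmostFisher {n : ℕ} (k l : ℕ) (𝓕 : Finset (Finset (Fin n))) : Prop :=
  ∀ F ∈ 𝓕, (𝓕.filter fun F' => F' ≠ F ∧ (F ∩ F').card ≠ l).card ≤ k

open Classical in
/-- `fisherMax n k l` is the maximum size of a `k`-almost `l`-Fisher family over an `n`-element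
ground set (the maximum is over a finite collection that contains the empty family). -/
noncomputable def fisherMax (n k l : ℕ) : ℕ :=
  (Finset.univ.filter fun 𝓕 : Finset (Finset (Fin n)) => IsAlmostFisher k l 𝓕).sup Finset.card

/-!
Write `|F ∩ F'| - l` as a matrix `B` indexed by the family (`gap`). Off the diagonal it is supported
on the conflict graph, which has maximum degree two, so that a kernel vector of `B` vanishing on a
vertex and one of its neighbours vanishes on the whole component (zero forcing). Any vectors whose
linear relations are kernel vectors of `B` therefore span dimension at least `m - 2` on a component
with `m` sets; and since indicator vectors are vertices of the cube, `m` is also bounded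
exponentially in the dimension.

* If all kernel vectors of `B` have coordinate sum zero, this applies to the indicator vectors
  extended by a constant coordinate `1`: the components span independent subspaces of
  `ℝ ^ (n + 1)`, and the two bounds give `2 m ≤ 3 d` for a component spanning dimension `d`
  (`two_mul_card_le_of_forall_sum_eq_zero`).
* Otherwise a kernel vector of sum one combines the indicator vectors to a *centre* `z`, with
  `z ⬝ z = l` and `z ⬝ 1_F = l` for every member `F` (`exists_isCentre_or`). The vectors `1_F - z`
  then have Gram matrix `B`, so that components span pairwise orthogonal subspaces, all of
  them orthogonal to `z`. Now `m ≤ d + 2` and `m ≤ 2 ^ d`, hence `2 m ≤ 3 d` unless `(d, m)` is one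
  of `(0, 1)`, `(1, 2)`, `(2, 4)`, `(3, 5)`.

The exceptional components are controlled by the coordinates where `z` is fractional, that is,
neither `0` nor `1`. In the first three types the sets are all the vertices of the cube in an affine
subspace, and a computation with an orthogonal basis shows that `1_F - z` vanishes off the
fractional coordinates, while `1 - 2 z`, cut down to them, lies in the span (`full_component`). In
the last type the conflict graph is a pentagon, the five sets satisfy an affine relation of one of
two shapes (a parallelogram, or `a + b + c = q + 2 o`), the second of which is impossible, and the
span still contains a nonzero vector supported on the fractional coordinates (`pentagon_component`).
In all types three of the sets cover the fractional coordinates (`cover_of_exceptional`). Hence: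

* `m ≤ 2 d`, apart from a component with `d = 0`; that one makes `z` Boolean, which rules out the
  other exceptional types. Summation gives the first bound.
* two components of the first three types make the cut-down `1 - 2 z` orthogonal to itself, so that
  `z` has values in `{0, 1 / 2, 1}` and `z ⬝ z = l` bounds the number of fractional coordinates;
  this number pays for the excess of `3 m` over `5 d`, and the second bound follows.
* two exceptional components of any type confine the fractional coordinates to nine intersections of
  size `l`, so that there are at most `9 l` of them; they pay for the excess of `2 m` over `3 d`,
  and the third bound follows, the first one being stronger when `9 l > n`.

Equality in the first bound holds for the `2 n - 2` level sets of the nonconstant columns of a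
normalized Hadamard matrix, where each set conflicts with its complement only. Sylvester's matrices
of order `2 ^ k` provide infinitely many cases.
-/

open Module

/-! ### Dimension counts and orthogonality -/

/-- If the only linear relation among the `x a`, `a ∈ s`, whose coefficients vanish on `T` is the
trivial one, then the `x a` span dimension at least `s.card - T.card`. -/
lemma card_le_finrank_span_add_card {V E : Type*} [Fintype V] [DecidableEq V] [AddCommGroup E]
    [Module ℝ E] [FiniteDimensional ℝ E] (x : V → E) (s T : Finset V)
    (h : ∀ α : V → ℝ, (∀ a ∉ s, α a = 0) → ∑ a, α a • x a = 0 → (∀ a ∈ T, α a = 0) → α = 0) :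
    s.card ≤ finrank ℝ (Submodule.span ℝ (x '' s)) + T.card := by
  classical
  let x' : s → Submodule.span ℝ (x '' s) :=
    fun a => ⟨x a, Submodule.subset_span ⟨a, a.2, rfl⟩⟩
  let Φ : (s → ℝ) →ₗ[ℝ] Submodule.span ℝ (x '' s) × (T → ℝ) :=
    LinearMap.prod (Fintype.linearCombination ℝ x')
      (LinearMap.pi fun t => if ht : (t : V) ∈ s then LinearMap.proj ⟨t, ht⟩ else 0)
  have hinj : Function.Injective Φ := by
    rw [← LinearMap.ker_eq_bot, LinearMap.ker_eq_bot']
    intro β hβ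
    have h1 : ∑ a : s, β a • x a = 0 := by
      have := congrArg Prod.fst hβ
      simpa [Φ, Fintype.linearCombination_apply, x'] using
        congrArg (Submodule.subtype (Submodule.span ℝ (x '' s))) this
    let α : V → ℝ := fun a => if ha : a ∈ s then β ⟨a, ha⟩ else 0
    have hα : α = 0 := by
      refine h α (fun a ha => by simp [α, ha]) ?_ ?_
      · rw [← h1, ← Finset.sum_subset (Finset.subset_univ s)
          (fun a _ ha => by simp [α, ha]), ← Finset.sum_coe_sort s]
        exact Finset.sum_congr rfl fun a _ => by simp [α]
      · intro a ha
        have h2 := congrFun (congrArg Prod.snd hβ) ⟨a, ha⟩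
        by_cases has : a ∈ s
        · simpa [Φ, α, has] using h2
        · simp [α, has]
    funext a
    simpa [α] using congrFun hα a
  have := LinearMap.finrank_le_finrank_of_injective hinj
  simpa using this

/-- Independent subspaces of `Z` have dimensions summing to at most the dimension of `Z`. -/
lemma sum_finrank_le_of_sum_eq_zero {κ E : Type*} [Fintype κ] [AddCommGroup E]
    [Module ℝ E] [FiniteDimensional ℝ E] (W : κ → Submodule ℝ E) (Z : Submodule ℝ E)
    (hWZ : ∀ c, W c ≤ Z)
    (h : ∀ w : κ → E, (∀ c, w c ∈ W c) → ∑ c, w c = 0 → ∀ c, w c = 0) :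
    ∑ c, finrank ℝ (W c) ≤ finrank ℝ Z := by
  let Φ : (∀ c, W c) →ₗ[ℝ] Z :=
    ∑ c, (Submodule.inclusion (hWZ c)).comp (LinearMap.proj c)
  have hinj : Function.Injective Φ := by
    rw [← LinearMap.ker_eq_bot, LinearMap.ker_eq_bot']
    intro β hβ
    have h1 : ∑ c, (β c : E) = 0 := by
      have := congrArg Z.subtype hβ
      simpa [Φ] using this
    funext c
    exact Subtype.ext (h (fun c => β c) (fun c => (β c).2) h1 c)
  have := LinearMap.finrank_le_finrank_of_injective hinj
  simpa [finrank_pi_fintype] using this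

/-- An affine subspace of dimension `d` contains at most `2 ^ d` vertices of the cube. -/
lemma card_le_two_pow_of_sub_mem {ι : Type*} [Finite ι] (d : ℕ) :
    ∀ (Y : Submodule ℝ (ι → ℝ)) (S : Finset (ι → ℝ)), finrank ℝ Y ≤ d →
      (∀ v ∈ S, ∀ i, v i = 0 ∨ v i = 1) → (∀ v ∈ S, ∀ w ∈ S, v - w ∈ Y) →
      S.card ≤ 2 ^ d := by
  classical
  induction d with
  | zero =>
    intro Y S hY _ hS
    have hbot : Y = ⊥ := Submodule.finrank_eq_zero.1 (by omega)
    simpa using Finset.card_le_one.2 fun v hv w hw => by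
      simpa [hbot, sub_eq_zero] using hS v hv w hw
  | succ d ih =>
    intro Y S hY h01 hS
    by_cases hcard : S.card ≤ 1
    · exact hcard.trans (Nat.one_le_two_pow)
    obtain ⟨v, hv, w, hw, hvw⟩ := Finset.one_lt_card.1 (not_le.1 hcard)
    obtain ⟨i, hi⟩ := Function.ne_iff.1 hvw
    let Y' : Submodule ℝ (ι → ℝ) := Y ⊓ LinearMap.ker (LinearMap.proj i)
    have hlt : Y' < Y := by
      refine lt_of_le_of_ne inf_le_left fun h => hi ?_
      have : v - w ∈ Y' := h ▸ hS v hv w hw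
      simpa [Y', sub_eq_zero] using this.2
    have hY' : finrank ℝ Y' ≤ d := by
      have := Submodule.finrank_lt_finrank_of_lt hlt
      omega
    have key : ∀ t : ℝ, (S.filter fun v => v i = t).card ≤ 2 ^ d := fun t => by
      refine ih Y' _ hY' (fun v hv => h01 v (Finset.mem_filter.1 hv).1) fun v hv w hw => ?_
      rw [Finset.mem_filter] at hv hw
      exact ⟨hS v hv.1 w hw.1, by simp [hv.2, hw.2]⟩
    have hsub : S ⊆ S.filter (fun v => v i = 0) ∪ S.filter (fun v => v i = 1) := by
      intro v hv
      rcases h01 v hv i with h | h <;> simp [hv, h]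
    calc S.card ≤ _ := Finset.card_le_card hsub
      _ ≤ _ := Finset.card_union_le _ _
      _ ≤ 2 ^ d + 2 ^ d := add_le_add (key 0) (key 1)
      _ = 2 ^ (d + 1) := by ring

/-- Pairwise orthogonal nonzero vectors, as many as the dimension, have trivial orthogonal
complement inside the subspace. -/
lemma eq_zero_of_dotProduct_orthogonal {ι : Type*} [Fintype ι] {d : ℕ}
    (Y : Submodule ℝ (ι → ℝ)) (hd : finrank ℝ Y ≤ d) (b : Fin d → ι → ℝ) (hb : ∀ j, b j ∈ Y)
    (hb0 : ∀ j, b j ⬝ᵥ b j ≠ 0) (horth : ∀ j k, j ≠ k → b j ⬝ᵥ b k = 0)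
    (g : ι → ℝ) (hg : g ∈ Y) (hgb : ∀ j, g ⬝ᵥ b j = 0) : g = 0 := by
  by_contra hne
  let w : Option (Fin d) → Y := fun o => o.elim ⟨g, hg⟩ fun j => ⟨b j, hb j⟩
  have hli : LinearIndependent ℝ w := by
    rw [Fintype.linearIndependent_iff]
    intro c hc
    have hc' : c none • g + ∑ j, c (some j) • b j = 0 := by
      have := congrArg Y.subtype hc
      simpa [w, Fintype.sum_option] using this
    intro o
    cases o with
    | none =>
      have h1 := congrArg (fun u => u ⬝ᵥ g) hc'
      have h2 : c none * (g ⬝ᵥ g) = 0 := by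
        have h3 : ∀ j, b j ⬝ᵥ g = 0 := fun j => by rw [dotProduct_comm, hgb]
        simpa only [add_dotProduct, sum_dotProduct, smul_dotProduct, h3, smul_eq_mul, mul_zero,
          Finset.sum_const_zero, add_zero, zero_dotProduct] using h1
      exact (mul_eq_zero.1 h2).resolve_right fun h => hne (dotProduct_self_eq_zero.1 h)
    | some k =>
      have h1 := congrArg (fun u => u ⬝ᵥ b k) hc'
      have h2 : ∑ j, c (some j) * (b j ⬝ᵥ b k) = 0 := by
        simpa [add_dotProduct, sum_dotProduct, smul_dotProduct, hgb] using h1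
      rw [Finset.sum_eq_single k (fun j _ hj => by rw [horth j k hj, mul_zero])
        (by simp)] at h2
      exact (mul_eq_zero.1 h2).resolve_right (hb0 k)
  have := hli.fintype_card_le_finrank
  simp at this
  omega

/-! ### Zero forcing in graphs of maximum degree two -/

section Forcing

variable {V : Type*} [Fintype V] {G : SimpleGraph V} {B : V → V → ℝ} {α : V → ℝ}

/-- If a kernel vector of a matrix supported on `G` vanishes on all but possibly one neighbour of
`a`, and at `a` itself, then it vanishes on that neighbour too. -/
lemma eq_zero_of_forall_adj_ne (hB0 : ∀ a b, a ≠ b → ¬ G.Adj a b → B a b = 0)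
    (hB1 : ∀ a b, G.Adj a b → B a b ≠ 0) (hα : ∀ a, ∑ b, B a b * α b = 0) {a b : V}
    (hab : G.Adj a b) (ha : α a = 0) (h : ∀ c, G.Adj a c → c ≠ b → α c = 0) : α b = 0 := by
  have h1 := hα a
  rw [Finset.sum_eq_single b] at h1
  · exact (mul_eq_zero.1 h1).resolve_left (hB1 a b hab)
  · intro c _ hc
    by_cases hac : a = c
    · rw [← hac, ha, mul_zero]
    by_cases hadj : G.Adj a c
    · rw [h c hadj hc, mul_zero]
    · rw [hB0 a c hac hadj, zero_mul]
  · simp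

/-- Zero forcing along a graph of maximum degree two: a kernel vector that vanishes on a closed
neighbourhood vanishes on the whole connected component. -/
lemma eq_zero_of_reachable (hB0 : ∀ a b, a ≠ b → ¬ G.Adj a b → B a b = 0)
    (hB1 : ∀ a b, G.Adj a b → B a b ≠ 0)
    (hdeg : ∀ a b c d, G.Adj a b → G.Adj a c → G.Adj a d → b = c ∨ b = d ∨ c = d)
    (hα : ∀ a, ∑ b, B a b * α b = 0) {a b : V} (hab : G.Reachable a b)
    (ha : α a = 0) (h : ∀ c, G.Adj a c → α c = 0) : α b = 0 := by
  obtain ⟨p⟩ := hab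
  suffices α b = 0 ∧ ∀ c, G.Adj b c → α c = 0 from this.1
  induction p with
  | nil => exact ⟨ha, h⟩
  | @cons a a' b hadj p ih =>
    refine ih (h _ hadj) fun c hc => ?_
    by_cases hca : c = a
    · rw [hca, ha]
    refine eq_zero_of_forall_adj_ne hB0 hB1 hα hc (h _ hadj) fun e he hec => ?_
    rcases hdeg a' a c e hadj.symm hc he with h1 | h1 | h1
    · exact absurd h1.symm hca
    · rw [← h1, ha]
    · exact absurd h1.symm hec

end Forcing

/-! ### Affine relations among few vertices of the cube -/

section CubeRelations

variable {ι : Type*}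

/-- Three distinct vertices of the cube are affinely independent. -/
lemma eq_zero_of_three_cube_points {b c d : ι → ℝ} (hb : ∀ i, b i = 0 ∨ b i = 1)
    (hc : ∀ i, c i = 0 ∨ c i = 1) (hd : ∀ i, d i = 0 ∨ d i = 1)
    (hbc : b ≠ c) (hbd : b ≠ d) (hcd : c ≠ d) {β γ δ : ℝ} (hsum : β + γ + δ = 0)
    (h : ∀ i, β * b i + γ * c i + δ * d i = 0) : β = 0 ∧ γ = 0 ∧ δ = 0 := by
  have key : ∀ {b c d : ι → ℝ}, (∀ i, b i = 0 ∨ b i = 1) → (∀ i, c i = 0 ∨ c i = 1) →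
      (∀ i, d i = 0 ∨ d i = 1) → b ≠ c → ∀ {β γ δ : ℝ}, β + γ + δ = 0 →
      (∀ i, β * b i + γ * c i + δ * d i = 0) → β = 0 ∨ γ = 0 := by
    intro b c d hb hc hd hbc β γ δ hsum h
    obtain ⟨i, hi⟩ := Function.ne_iff.1 hbc
    have h1 := h i
    rcases hb i with hb | hb <;> rcases hc i with hc | hc <;> rcases hd i with hd | hd <;>
      simp only [hb, hc, hd, ne_eq, not_true_eq_false] at h1 hi
    · right; linarith
    · left; linarith
    · left; linarith
    · right; linarith
  rcases key hb hc hd hbc hsum h with h1 | h1 <;>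
  rcases key hb hd hc hbd (by linarith : β + δ + γ = 0) (fun i => by linarith [h i])
    with h2 | h2 <;>
  rcases key hc hd hb hcd (by linarith : γ + δ + β = 0) (fun i => by linarith [h i])
    with h3 | h3 <;>
  refine ⟨?_, ?_, ?_⟩ <;> linarith

/-- Four distinct vertices of the cube that are affinely dependent form a parallelogram. -/
lemma parallelogram_of_cube_relation {a b c d : ι → ℝ} (ha : ∀ i, a i = 0 ∨ a i = 1)
    (hb : ∀ i, b i = 0 ∨ b i = 1) (hc : ∀ i, c i = 0 ∨ c i = 1) (hd : ∀ i, d i = 0 ∨ d i = 1)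
    (hab : a ≠ b) (hac : a ≠ c) (had : a ≠ d) (hbc : b ≠ c) (hbd : b ≠ d) (hcd : c ≠ d)
    {α β γ δ : ℝ} (hne : ¬ (α = 0 ∧ β = 0 ∧ γ = 0 ∧ δ = 0)) (hsum : α + β + γ + δ = 0)
    (h : ∀ i, α * a i + β * b i + γ * c i + δ * d i = 0) :
    a + b = c + d ∨ a + c = b + d ∨ a + d = b + c := by
  have hα : α ≠ 0 := fun h0 => hne ⟨h0, eq_zero_of_three_cube_points hb hc hd hbc hbd hcd
    (by linarith) fun i => by have := h i; rw [h0] at this; linarith⟩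
  have hβ : β ≠ 0 := fun h0 => by
    have := eq_zero_of_three_cube_points (β := α) (γ := γ) (δ := δ) ha hc hd hac had hcd
      (by linarith) fun i => by have := h i; rw [h0] at this; linarith
    exact hα this.1
  have hγ : γ ≠ 0 := fun h0 => by
    have := eq_zero_of_three_cube_points (β := α) (γ := β) (δ := δ) ha hb hd hab had hbd
      (by linarith) fun i => by have := h i; rw [h0] at this; linarith
    exact hα this.1
  have hδ : δ ≠ 0 := fun h0 => by
    have := eq_zero_of_three_cube_points (β := α) (γ := β) (δ := γ) ha hb hc hab hac hbc
      (by linarith) fun i => by have := h i; rw [h0] at this; linarith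
    exact hα this.1
  have key : ∀ {a b c d : ι → ℝ}, (∀ i, a i = 0 ∨ a i = 1) → (∀ i, b i = 0 ∨ b i = 1) →
      (∀ i, c i = 0 ∨ c i = 1) → (∀ i, d i = 0 ∨ d i = 1) → a ≠ b → ∀ {α β γ δ : ℝ},
      α ≠ 0 → β ≠ 0 → α + β + γ + δ = 0 →
      (∀ i, α * a i + β * b i + γ * c i + δ * d i = 0) → α + γ = 0 ∨ α + δ = 0 := by
    intro a b c d ha hb hc hd hab α β γ δ hα hβ hsum h
    obtain ⟨i, hi⟩ := Function.ne_iff.1 hab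
    have h1 := h i
    rcases ha i with ha | ha <;> rcases hb i with hb | hb <;> rcases hc i with hc | hc <;>
      rcases hd i with hd | hd <;>
      simp only [ha, hb, hc, hd, ne_eq, not_true_eq_false] at h1 hi <;>
    first
    | (exact absurd (by linarith) hα)
    | (exact absurd (by linarith) hβ)
    | (left; linarith)
    | (right; linarith)
  have fin : ∀ {a b c d : ι → ℝ} {α β γ δ : ℝ}, α ≠ 0 → α + β = 0 → α + γ = 0 →
      α + β + γ + δ = 0 → (∀ i, α * a i + β * b i + γ * c i + δ * d i = 0) →
      a + d = b + c := by
    intro a b c d α β γ δ hα h1 h2 h3 h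
    funext i
    have h4 : α * (a i + d i - (b i + c i)) = 0 := by
      have e1 : β = -α := by linarith
      have e2 : γ = -α := by linarith
      have e3 : δ = α := by linarith
      have := h i
      rw [e1, e2, e3] at this
      linarith
    have := (mul_eq_zero.1 h4).resolve_left hα
    simp only [Pi.add_apply]
    linarith
  rcases key ha hb hc hd hab hα hβ hsum h with h1 | h1 <;>
  rcases key ha hc hb hd hac hα hγ (by linarith : α + γ + β + δ = 0) (fun i => by linarith [h i])
    with h2 | h2 <;>
  rcases key ha hd hb hc had hα hδ (by linarith : α + δ + β + γ = 0) (fun i => by linarith [h i])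
    with h3 | h3
  · exact Or.inr (Or.inr (fin hα h2 h1 hsum h))
  · exact Or.inr (Or.inr (fin hα h2 h1 hsum h))
  · exact absurd (by linarith) hα
  · exact Or.inl (fin hα h1 h2 (by linarith : α + γ + δ + β = 0) fun i => by linarith [h i])
  · exact Or.inr (Or.inl (fin hα h2 h1 (by linarith : α + β + δ + γ = 0)
      fun i => by linarith [h i]))
  · exact absurd (by linarith) hα
  · exact Or.inr (Or.inl (fin hα h3 h1 (by linarith : α + β + δ + γ = 0)
      fun i => by linarith [h i]))
  · exact Or.inl (fin hα h3 h2 (by linarith : α + γ + δ + β = 0) fun i => by linarith [h i])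

lemma sum_fin_five {M : Type*} [AddCommMonoid M] (f : Fin 5 → M) {j k l m r : Fin 5}
    (h : [j, k, l, m, r].Nodup) : ∑ i, f i = f j + (f k + (f l + (f m + f r))) := by
  have huniv : (Finset.univ : Finset (Fin 5)) = [j, k, l, m, r].toFinset :=
    (Finset.eq_univ_of_card _ (by rw [List.toFinset_card_of_nodup h]; rfl)).symm
  rw [huniv, List.sum_toFinset _ h]
  simp

/-- Five distinct vertices of the cube with an affine dependency that involves all of them form a
bipyramid: if `a`, `b`, `c` are the indices other than `o` and `q`, the dependency reads
`v a + v b + v c = v q + 2 • v o`, which is stated here symmetrically. -/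
lemma bipyramid_of_cube_relation {v : Fin 5 → ι → ℝ} (hv : ∀ j i, v j i = 0 ∨ v j i = 1)
    (hinj : Function.Injective v) {α : Fin 5 → ℝ} (hα : ∀ j, α j ≠ 0) (hsum : ∑ j, α j = 0)
    (h : ∀ i, ∑ j, α j * v j i = 0) :
    ∃ o q, o ≠ q ∧ ∑ j, v j = (2 : ℝ) • v q + (3 : ℝ) • v o := by
  -- a coordinate separating `j` from `k` pairs one of them with a third index of opposite weight
  have key : ∀ j k, j ≠ k → ∃ l, l ≠ j ∧ l ≠ k ∧ (α j + α l = 0 ∨ α k + α l = 0) := by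
    intro j k hjk
    obtain ⟨l, m, r, hnd⟩ : ∃ l m r, [j, k, l, m, r].Nodup := by revert j k; decide
    obtain ⟨i, hi⟩ := Function.ne_iff.1 fun h => hjk (hinj h)
    have h1 := h i
    rw [sum_fin_five _ hnd] at h1 hsum
    simp only [List.nodup_cons, List.mem_cons, List.not_mem_nil, or_false, not_or] at hnd
    have key' : α j + α l = 0 ∨ α k + α l = 0 ∨ α j + α m = 0 ∨ α k + α m = 0 ∨ α j + α r = 0 ∨
        α k + α r = 0 := by
      have hj0 := hα j
      have hk0 := hα k
      rcases hv j i with hj | hj <;> rcases hv k i with hk | hk <;> rcases hv l i with hl | hl <;>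
      rcases hv m i with hm | hm <;> rcases hv r i with hr | hr <;>
      simp only [hj, hk, hl, hm, hr, ne_eq, not_true_eq_false, mul_zero, mul_one, add_zero,
        zero_add] at h1 hi <;>
      first
      | (exact absurd h1 hj0)
      | (exact absurd h1 hk0)
      | (exact absurd (by linarith) hj0)
      | (exact absurd (by linarith) hk0)
      | (left; linarith)
      | (right; left; linarith)
      | (right; right; left; linarith)
      | (right; right; right; left; linarith)
      | (right; right; right; right; left; linarith)
      | (right; right; right; right; right; linarith)
    rcases key' with h2 | h2 | h2 | h2 | h2 | h2
    · exact ⟨l, Ne.symm hnd.1.2.1, Ne.symm hnd.2.1.1, Or.inl h2⟩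
    · exact ⟨l, Ne.symm hnd.1.2.1, Ne.symm hnd.2.1.1, Or.inr h2⟩
    · exact ⟨m, Ne.symm hnd.1.2.2.1, Ne.symm hnd.2.1.2.1, Or.inl h2⟩
    · exact ⟨m, Ne.symm hnd.1.2.2.1, Ne.symm hnd.2.1.2.1, Or.inr h2⟩
    · exact ⟨r, Ne.symm hnd.1.2.2.2, Ne.symm hnd.2.1.2.2, Or.inl h2⟩
    · exact ⟨r, Ne.symm hnd.1.2.2.2, Ne.symm hnd.2.1.2.2, Or.inr h2⟩
  -- indices of weights `a`, `-a`
  obtain ⟨j, l, hjl, hjl0⟩ : ∃ j l, j ≠ l ∧ α j + α l = 0 := by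
    obtain ⟨l, h0, h1, h2 | h2⟩ := key 0 1 (by decide)
    · exact ⟨0, l, h0.symm, h2⟩
    · exact ⟨1, l, h1.symm, h2⟩
  -- a third index of weight `± a`
  obtain ⟨m, hmj, hml, hm⟩ := key j l hjl
  obtain ⟨r, s, hnd⟩ : ∃ r s, [j, l, m, r, s].Nodup := by
    clear hm hjl0 key h hsum hα hinj hv
    revert j l m; decide
  -- a fourth one, which may be taken to be `r` rather than `s`
  have main : ∀ r s, [j, l, m, r, s].Nodup → (α r = α j ∨ α r = - α j) →
      ∃ o q, o ≠ q ∧ ∑ j, v j = (2 : ℝ) • v q + (3 : ℝ) • v o := by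
    intro r s hnd hr
    have hs := hsum
    rw [sum_fin_five _ hnd] at hs
    have hj0 := hα j
    have hs0 := hα s
    have fin : ∀ q, q ≠ s → (∀ i, α j * (v j i + (v l i + (v m i + (v r i + v s i)))) =
        α j * (2 * v q i + 3 * v s i)) →
        ∃ o q, o ≠ q ∧ ∑ j, v j = (2 : ℝ) • v q + (3 : ℝ) • v o := by
      intro q hq hi
      refine ⟨s, q, hq.symm, ?_⟩
      rw [sum_fin_five _ hnd]
      funext i
      simpa using mul_left_cancel₀ hj0 (hi i)
    have hl : α l = - α j := by linarith
    have h' : ∀ i, α j * v j i + (α l * v l i + (α m * v m i + (α r * v r i + α s * v s i))) = 0 :=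
      fun i => by rw [← h i, sum_fin_five _ hnd]
    simp only [List.nodup_cons, List.mem_cons, List.not_mem_nil, or_false, not_or] at hnd
    have hm' : α m = α j ∨ α m = - α j := by
      rcases hm with hm | hm
      · right; linarith
      · left; linarith
    rcases hm' with hm' | hm' <;> rcases hr with hr | hr
    · refine fin l hnd.2.1.2.2 fun i => ?_
      have := h' i
      have hs' : α s = - 2 * α j := by linarith
      rw [hl, hm', hr, hs'] at this
      linarith
    · exact absurd (by linarith) hs0
    · exact absurd (by linarith) hs0
    · refine fin j hnd.1.2.2.2 fun i => ?_
      have := h' i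
      have hs' : α s = 2 * α j := by linarith
      rw [hl, hm', hr, hs'] at this
      linarith
  have hl : α l = - α j := by linarith
  have hm' : α m = α j ∨ α m = - α j := by
    rcases hm with hm | hm
    · right; linarith
    · left; linarith
  have hnd' : [j, l, m, s, r].Nodup := (List.Perm.nodup_iff (by
    simpa using List.Perm.swap s r [])).1 hnd
  have hrs : r ≠ s := by
    simp only [List.nodup_cons, List.mem_cons, List.not_mem_nil, or_false, not_or] at hnd
    exact hnd.2.2.2.1
  obtain ⟨t, htr, hts, ht⟩ := key r s hrs
  have ht' : α t = α j ∨ α t = - α j := by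
    have htm : t = j ∨ t = l ∨ t = m := by
      clear ht hm' hl main key hm hjl0 h hsum hα hinj hv hnd'
      revert j l m r s t; decide
    rcases htm with rfl | rfl | rfl
    · exact Or.inl rfl
    · exact Or.inr hl
    · exact hm'
  rcases ht with ht | ht
  · refine main r s hnd ?_
    rcases ht' with h2 | h2
    · right; linarith
    · left; linarith
  · refine main s r hnd' ?_
    rcases ht' with h2 | h2
    · right; linarith
    · left; linarith

end CubeRelations

/-! ### Vertices of the cube spanning a small space as seen from a point -/

section Geometry

variable {ι : Type*}

/-- `y` is a vertex of the unit cube as seen from `z`, that is, `y + z` has coordinates `0` and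
`1`. -/
def IsCubeVertexFrom (z y : ι → ℝ) : Prop := ∀ i, y i = - z i ∨ y i = 1 - z i

/-- The functions supported on the coordinates where `z` is fractional, that is, neither `0` nor
`1`. -/
def fracSupported (z : ι → ℝ) : Submodule ℝ (ι → ℝ) where
  carrier := {u | ∀ i, z i = 0 ∨ z i = 1 → u i = 0}
  add_mem' ha hb i hi := by simp [ha i hi, hb i hi]
  zero_mem' i _ := rfl
  smul_mem' c u hu i hi := by simp [hu i hi]

open Classical in
/-- The vector `1 - 2 z` on the coordinates where `z` is fractional, and `0` elsewhere. -/
noncomputable def halfDefect (z : ι → ℝ) : ι → ℝ :=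
  fun i => if z i = 0 ∨ z i = 1 then 0 else 1 - 2 * z i

lemma IsCubeVertexFrom.add_mem {z y : ι → ℝ} (h : IsCubeVertexFrom z y) (i : ι) :
    (y + z) i = 0 ∨ (y + z) i = 1 := by
  rcases h i with h | h <;> rw [Pi.add_apply, h]
  · left; ring
  · right; ring

variable [Fintype ι] {z : ι → ℝ}

/-- More than `m` points in an affine space of dimension less than `m` through `z` are affinely
dependent. -/
lemma exists_affine_relation {m : ℕ} (v : Fin (m + 1) → ι → ℝ) (Y : Submodule ℝ (ι → ℝ))
    (hY : finrank ℝ Y < m) (hv : ∀ j, v j - z ∈ Y) :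
    ∃ α : Fin (m + 1) → ℝ, (∃ j, α j ≠ 0) ∧ ∑ j, α j = 0 ∧ ∀ i, ∑ j, α j * v j i = 0 := by
  let w : Fin m → Y := fun j => ⟨v j.succ - v 0, by
    simpa using Y.sub_mem (hv j.succ) (hv 0)⟩
  have hw : ¬ LinearIndependent ℝ w := fun h => by
    have := h.fintype_card_le_finrank
    simp at this
    omega
  rw [Fintype.not_linearIndependent_iff] at hw
  obtain ⟨g, hg, j, hj⟩ := hw
  refine ⟨Fin.cons (- ∑ j, g j) g, ⟨j.succ, by simpa using hj⟩, by simp [Fin.sum_univ_succ],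
    fun i => ?_⟩
  have h1 := congrFun (congrArg Y.subtype hg) i
  simp only [map_sum, map_smul, Submodule.subtype_apply, w, Finset.sum_apply, Pi.smul_apply,
    Pi.sub_apply, smul_eq_mul, mul_sub, Finset.sum_sub_distrib, ← Finset.sum_mul,
    map_zero, Pi.zero_apply] at h1
  simp only [Fin.sum_univ_succ, Fin.cons_zero, Fin.cons_succ]
  linarith

lemma dotProduct_self_pos_of_dotProduct_ne_zero {y w : ι → ℝ} (h : y ⬝ᵥ w ≠ 0) :
    0 < y ⬝ᵥ y := by
  refine lt_of_le_of_ne (Finset.sum_nonneg fun _ _ => mul_self_nonneg _) fun h0 => h ?_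
  rw [dotProduct_self_eq_zero.1 h0.symm, zero_dotProduct]

lemma dotProduct_self_pos_of_ne {y w : ι → ℝ} (h : y ≠ w) : 0 < (y - w) ⬝ᵥ (y - w) :=
  lt_of_le_of_ne (Finset.sum_nonneg fun _ _ => mul_self_nonneg _) fun h0 =>
    h (sub_eq_zero.1 (dotProduct_self_eq_zero.1 h0.symm))

lemma eq_zero_of_dotProduct_orthogonal_two (Y : Submodule ℝ (ι → ℝ)) (hY : finrank ℝ Y ≤ 2)
    {a b g : ι → ℝ} (ha : a ∈ Y) (hb : b ∈ Y) (hg : g ∈ Y) (ha0 : 0 < a ⬝ᵥ a)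
    (hb0 : 0 < b ⬝ᵥ b) (hab : a ⬝ᵥ b = 0) (hga : g ⬝ᵥ a = 0) (hgb : g ⬝ᵥ b = 0) : g = 0 := by
  have hba : b ⬝ᵥ a = 0 := by rw [dotProduct_comm, hab]
  refine eq_zero_of_dotProduct_orthogonal Y hY ![a, b] ?_ ?_ ?_ g hg ?_
  · simp [Fin.forall_fin_succ, ha, hb]
  · simp only [Fin.forall_fin_succ, Matrix.cons_val_zero, Matrix.cons_val_succ]
    exact ⟨ha0.ne', hb0.ne', by simp⟩
  · simp [Fin.forall_fin_succ, hab, hba]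
  · simp [Fin.forall_fin_succ, hga, hgb]

lemma eq_zero_of_dotProduct_orthogonal_three (Y : Submodule ℝ (ι → ℝ)) (hY : finrank ℝ Y ≤ 3)
    {a b c g : ι → ℝ} (ha : a ∈ Y) (hb : b ∈ Y) (hc : c ∈ Y) (hg : g ∈ Y) (ha0 : 0 < a ⬝ᵥ a)
    (hb0 : 0 < b ⬝ᵥ b) (hc0 : 0 < c ⬝ᵥ c) (hab : a ⬝ᵥ b = 0) (hac : a ⬝ᵥ c = 0)
    (hbc : b ⬝ᵥ c = 0) (hga : g ⬝ᵥ a = 0) (hgb : g ⬝ᵥ b = 0) (hgc : g ⬝ᵥ c = 0) : g = 0 := by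
  have hba : b ⬝ᵥ a = 0 := by rw [dotProduct_comm, hab]
  have hca : c ⬝ᵥ a = 0 := by rw [dotProduct_comm, hac]
  have hcb : c ⬝ᵥ b = 0 := by rw [dotProduct_comm, hbc]
  refine eq_zero_of_dotProduct_orthogonal Y hY ![a, b, c] ?_ ?_ ?_ g hg ?_
  · simp [Fin.forall_fin_succ, ha, hb, hc]
  · simp only [Fin.forall_fin_succ, Matrix.cons_val_zero, Matrix.cons_val_succ]
    exact ⟨ha0.ne', hb0.ne', hc0.ne', by simp⟩
  · simp [Fin.forall_fin_succ, hab, hba, hac, hca, hbc, hcb]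
  · simp [Fin.forall_fin_succ, hga, hgb, hgc]

/-- Two vertices of the cube that are collinear with `z` but not orthogonal as seen from it differ
exactly in the fractional coordinates of `z`. -/
lemma fracSupported_of_pair (Y : Submodule ℝ (ι → ℝ)) (hY : finrank ℝ Y ≤ 1) {y₁ y₂ : ι → ℝ}
    (h₁ : y₁ ∈ Y) (h₂ : y₂ ∈ Y) (c₁ : IsCubeVertexFrom z y₁) (c₂ : IsCubeVertexFrom z y₂)
    (hne : y₁ ≠ y₂) (h12 : y₁ ⬝ᵥ y₂ ≠ 0) :
    y₁ ∈ fracSupported z ∧ y₂ ∈ fracSupported z ∧ halfDefect z ∈ Y := by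
  have h11 := dotProduct_self_pos_of_dotProduct_ne_zero h12
  obtain ⟨c, hc⟩ : ∃ c, c = (y₁ ⬝ᵥ y₂) / (y₁ ⬝ᵥ y₁) := ⟨_, rfl⟩
  have hc0 : c ≠ 0 := hc ▸ div_ne_zero h12 h11.ne'
  have hg : y₂ - c • y₁ = 0 := by
    refine eq_zero_of_dotProduct_orthogonal Y hY ![y₁] (by simp [h₁]) ?_ (by simp)
      _ (Y.sub_mem h₂ (Y.smul_mem _ h₁)) ?_
    · intro j
      simpa using fun h => h11.ne' (by rw [h, zero_dotProduct])
    · intro j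
      simp only [Matrix.cons_val_fin_one, sub_dotProduct, smul_dotProduct, smul_eq_mul]
      rw [hc, div_mul_cancel₀ _ h11.ne', dotProduct_comm, sub_self]
  have hp : ∀ i, y₂ i = c * y₁ i := fun i => by
    have := congrFun hg i
    simp only [Pi.sub_apply, Pi.smul_apply, smul_eq_mul, Pi.zero_apply] at this
    linarith
  have hc1 : c ≠ 1 := fun h => hne (by funext i; rw [hp i, h, one_mul])
  have hc1' : 1 - c ≠ 0 := sub_ne_zero.2 hc1.symm
  -- where the two sets agree, both vectors vanish and `z` is Boolean
  have hfrac : y₁ ∈ fracSupported z := by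
    intro i hi
    have hpi := hp i
    rcases c₁ i with h1 | h1 <;> rcases c₂ i with h2 | h2 <;> rcases hi with hz | hz <;>
      rw [h1, h2, hz] at hpi <;> rw [h1, hz]
    all_goals first
      | norm_num; done
      | (exfalso; exact hc0 (by linarith))
      | (exfalso; exact hc1 (by linarith))
  refine ⟨hfrac, fun i hi => by rw [hp i, hfrac i hi, mul_zero], ?_⟩
  have : halfDefect z = (1 + c) • y₁ := by
    funext i
    simp only [halfDefect, Pi.smul_apply, smul_eq_mul]
    split_ifs with hi
    · rw [hfrac i hi, mul_zero]
    · have hpi := hp i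
      rcases c₁ i with h1 | h1 <;> rcases c₂ i with h2 | h2 <;> rw [h1, h2] at hpi <;> rw [h1]
      · exact absurd (Or.inl ((mul_eq_zero.1 (by linarith : (1 - c) * z i = 0)).resolve_left
          hc1')) hi
      · linarith
      · linarith
      · refine absurd (Or.inr ?_) hi
        have := (mul_eq_zero.1 (by linarith : (1 - c) * (1 - z i) = 0)).resolve_left hc1'
        linarith
  rw [this]
  exact Y.smul_mem _ h₁

/-- Inner products with `a` can be compared through those with the nonnegative vector `a + z` when
the other factors are orthogonal to `z`. -/
lemma dotProduct_le_of_shift_le {a b c : ι → ℝ} (hb : z ⬝ᵥ b = 0) (hc : z ⬝ᵥ c = 0)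
    (h : ∀ i, (a i + z i) * c i ≤ (a i + z i) * b i) : a ⬝ᵥ c ≤ a ⬝ᵥ b := by
  have h1 : (a + z) ⬝ᵥ c ≤ (a + z) ⬝ᵥ b := Finset.sum_le_sum fun i _ => h i
  rwa [add_dotProduct, add_dotProduct, hb, hc, add_zero, add_zero] at h1

/-- In a parallelogram `y₁ + y₃ = y₂ + y₄` of cube vertices with both diagonals orthogonal pairs,
the sides have positive inner products, so that the expansion of `y₄` in the orthogonal basis
`y₁`, `y₃` contradicts `y₂ ⬝ᵥ y₄ = 0`. -/
lemma false_of_parallelogram_orthogonal_diagonals (Y : Submodule ℝ (ι → ℝ))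
    (hY : finrank ℝ Y ≤ 2) {y₁ y₂ y₃ y₄ : ι → ℝ} (h₁ : y₁ ∈ Y) (h₃ : y₃ ∈ Y) (h₄ : y₄ ∈ Y)
    (c₁ : IsCubeVertexFrom z y₁) (c₂ : IsCubeVertexFrom z y₂) (c₃ : IsCubeVertexFrom z y₃)
    (c₄ : IsCubeVertexFrom z y₄)
    (o₁ : z ⬝ᵥ y₁ = 0) (o₂ : z ⬝ᵥ y₂ = 0) (o₃ : z ⬝ᵥ y₃ = 0) (o₄ : z ⬝ᵥ y₄ = 0)
    (h13 : y₁ ⬝ᵥ y₃ = 0) (h24 : y₂ ⬝ᵥ y₄ = 0) (h12 : y₁ ⬝ᵥ y₂ ≠ 0) (h23 : y₃ ⬝ᵥ y₂ ≠ 0)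
    (h14 : y₁ ⬝ᵥ y₄ ≠ 0) (h34 : y₃ ⬝ᵥ y₄ ≠ 0) (hrel : y₁ + y₃ = y₂ + y₄) : False := by
  have hr : ∀ i, y₁ i + y₃ i = y₂ i + y₄ i := fun i => congrFun hrel i
  have h31 : y₃ ⬝ᵥ y₁ = 0 := by rw [dotProduct_comm, h13]
  have p12 : 0 < y₁ ⬝ᵥ y₂ := by
    refine lt_of_le_of_ne (h13 ▸ dotProduct_le_of_shift_le o₂ o₃ fun i => ?_) h12.symm
    have := hr i
    rcases c₁ i with a | a <;> rcases c₂ i with b | b <;> rcases c₃ i with c | c <;>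
      rcases c₄ i with d | d <;> rw [a, b, c, d] at this <;> rw [a, b, c] <;> linarith
  have p14 : 0 < y₁ ⬝ᵥ y₄ := by
    refine lt_of_le_of_ne (h13 ▸ dotProduct_le_of_shift_le o₄ o₃ fun i => ?_) h14.symm
    have := hr i
    rcases c₁ i with a | a <;> rcases c₂ i with b | b <;> rcases c₃ i with c | c <;>
      rcases c₄ i with d | d <;> rw [a, b, c, d] at this <;> rw [a, d, c] <;> linarith
  have p32 : 0 < y₃ ⬝ᵥ y₂ := by
    refine lt_of_le_of_ne (h31 ▸ dotProduct_le_of_shift_le o₂ o₁ fun i => ?_) h23.symm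
    have := hr i
    rcases c₁ i with a | a <;> rcases c₂ i with b | b <;> rcases c₃ i with c | c <;>
      rcases c₄ i with d | d <;> rw [a, b, c, d] at this <;> rw [a, b, c] <;> linarith
  have p34 : 0 < y₃ ⬝ᵥ y₄ := by
    refine lt_of_le_of_ne (h31 ▸ dotProduct_le_of_shift_le o₄ o₁ fun i => ?_) h34.symm
    have := hr i
    rcases c₁ i with a | a <;> rcases c₂ i with b | b <;> rcases c₃ i with c | c <;>
      rcases c₄ i with d | d <;> rw [a, b, c, d] at this <;> rw [a, d, c] <;> linarith
  have p11 := dotProduct_self_pos_of_dotProduct_ne_zero h12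
  have p33 := dotProduct_self_pos_of_dotProduct_ne_zero h34
  have hg : y₄ - ((y₁ ⬝ᵥ y₄) / (y₁ ⬝ᵥ y₁)) • y₁ - ((y₃ ⬝ᵥ y₄) / (y₃ ⬝ᵥ y₃)) • y₃ = 0 := by
    refine eq_zero_of_dotProduct_orthogonal_two Y hY h₁ h₃
      (Y.sub_mem (Y.sub_mem h₄ (Y.smul_mem _ h₁)) (Y.smul_mem _ h₃)) p11 p33 h13 ?_ ?_
    · rw [sub_dotProduct, sub_dotProduct, smul_dotProduct, smul_dotProduct, smul_eq_mul,
        smul_eq_mul, h31, div_mul_cancel₀ _ p11.ne', dotProduct_comm y₄]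
      ring
    · rw [sub_dotProduct, sub_dotProduct, smul_dotProduct, smul_dotProduct, smul_eq_mul,
        smul_eq_mul, h13, div_mul_cancel₀ _ p33.ne', dotProduct_comm y₄]
      ring
  have h1 := congrArg (fun u => u ⬝ᵥ y₂) hg
  simp only [sub_dotProduct, smul_dotProduct, smul_eq_mul, zero_dotProduct] at h1
  rw [dotProduct_comm y₄, h24] at h1
  have : 0 < (y₁ ⬝ᵥ y₄) / (y₁ ⬝ᵥ y₁) * (y₁ ⬝ᵥ y₂) := by positivity
  have : 0 < (y₃ ⬝ᵥ y₄) / (y₃ ⬝ᵥ y₃) * (y₃ ⬝ᵥ y₂) := by positivity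
  linarith

/-- A parallelogram `y₁ + y₂ = y₃ + y₄` of cube vertices with the sides `y₁, y₃` and `y₂, y₄`
orthogonal pairs: `y₁ - y₃` and `y₁ - y₄` form an orthogonal basis in which all four vectors and
`halfDefect z` are explicit. -/
lemma fracSupported_of_parallelogram_orthogonal_sides (Y : Submodule ℝ (ι → ℝ))
    (hY : finrank ℝ Y ≤ 2) {y₁ y₂ y₃ y₄ : ι → ℝ} (h₁ : y₁ ∈ Y) (h₃ : y₃ ∈ Y) (h₄ : y₄ ∈ Y)
    (c₁ : IsCubeVertexFrom z y₁) (c₂ : IsCubeVertexFrom z y₂) (c₃ : IsCubeVertexFrom z y₃)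
    (c₄ : IsCubeVertexFrom z y₄) (n13 : y₁ ≠ y₃) (n14 : y₁ ≠ y₄)
    (h13 : y₁ ⬝ᵥ y₃ = 0) (h24 : y₂ ⬝ᵥ y₄ = 0) (hrel : y₁ + y₂ = y₃ + y₄) :
    (y₁ ∈ fracSupported z ∧ y₂ ∈ fracSupported z ∧ y₃ ∈ fracSupported z ∧
      y₄ ∈ fracSupported z) ∧ halfDefect z ∈ Y := by
  have hr : ∀ i, y₁ i + y₂ i = y₃ i + y₄ i := fun i => congrFun hrel i
  have hP : 0 < (y₁ - y₃) ⬝ᵥ (y₁ - y₃) := dotProduct_self_pos_of_ne n13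
  have hQ : 0 < (y₁ - y₄) ⬝ᵥ (y₁ - y₄) := dotProduct_self_pos_of_ne n14
  have hPQ : (y₁ - y₃) ⬝ᵥ (y₁ - y₄) = 0 := Finset.sum_eq_zero fun i _ => by
    have := hr i
    simp only [Pi.sub_apply]
    rcases c₁ i with a | a <;> rcases c₂ i with b | b <;> rcases c₃ i with c | c <;>
      rcases c₄ i with d | d <;> rw [a, b, c, d] at this <;> rw [a, c, d] <;>
      first | (exfalso; linarith) | ring
  have e2 : y₂ = y₁ - (y₁ - y₃) - (y₁ - y₄) := by
    funext i
    have := hr i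
    simp only [Pi.sub_apply]
    linarith
  obtain ⟨P, hPdef⟩ : ∃ P, P = y₁ - y₃ := ⟨_, rfl⟩
  obtain ⟨Q, hQdef⟩ : ∃ Q, Q = y₁ - y₄ := ⟨_, rfl⟩
  have e3 : y₃ = y₁ - P := by rw [hPdef]; abel
  have e4 : y₄ = y₁ - Q := by rw [hQdef]; abel
  rw [← hPdef, ← hQdef] at e2 hPQ
  rw [← hPdef] at hP
  rw [← hQdef] at hQ
  have q1 : y₁ ⬝ᵥ y₁ = y₁ ⬝ᵥ P := by
    rw [e3, dotProduct_sub] at h13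
    linarith
  have q2 : Q ⬝ᵥ Q = 2 * (y₁ ⬝ᵥ Q) := by
    rw [e2, e4] at h24
    simp only [sub_dotProduct, dotProduct_sub] at h24
    rw [dotProduct_comm P y₁, dotProduct_comm Q y₁] at h24
    linarith
  have hPY : P ∈ Y := hPdef ▸ Y.sub_mem h₁ h₃
  have hQY : Q ∈ Y := hQdef ▸ Y.sub_mem h₁ h₄
  obtain ⟨ξ, hξ⟩ : ∃ ξ, ξ = (y₁ ⬝ᵥ P) / (P ⬝ᵥ P) := ⟨_, rfl⟩
  have hξP : ξ * (P ⬝ᵥ P) = y₁ ⬝ᵥ P := by rw [hξ, div_mul_cancel₀ _ hP.ne']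
  have hg : y₁ - ξ • P - (1 / 2 : ℝ) • Q = 0 := by
    refine eq_zero_of_dotProduct_orthogonal_two Y hY hPY hQY
      (Y.sub_mem (Y.sub_mem h₁ (Y.smul_mem _ hPY)) (Y.smul_mem _ hQY)) hP hQ hPQ ?_ ?_
    · rw [sub_dotProduct, sub_dotProduct, smul_dotProduct, smul_dotProduct, smul_eq_mul,
        smul_eq_mul, hξP, dotProduct_comm Q, hPQ]
      ring
    · rw [sub_dotProduct, sub_dotProduct, smul_dotProduct, smul_dotProduct, smul_eq_mul,
        smul_eq_mul, hPQ, q2]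
      ring
  have hy : y₁ = ξ • P + (1 / 2 : ℝ) • Q := by
    rw [sub_sub, sub_eq_zero] at hg
    exact hg
  -- `ξ (1 - ξ) |P|² = |Q|² / 4`, so `ξ` lies strictly between `0` and `1`
  have q3 : ξ * ξ * (P ⬝ᵥ P) + (Q ⬝ᵥ Q) / 4 = ξ * (P ⬝ᵥ P) := by
    rw [hξP, ← q1]
    conv_rhs => rw [hy]
    simp only [add_dotProduct, dotProduct_add, smul_dotProduct, dotProduct_smul, smul_eq_mul, hPQ,
      dotProduct_comm Q P]
    ring
  have hξ0 : ξ ≠ 0 := fun h => by rw [h] at q3; linarith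
  have hξ1 : ξ ≠ 1 := fun h => by rw [h] at q3; linarith
  have hp : ∀ i, y₁ i = ξ * (y₁ i - y₃ i) + (y₁ i - y₄ i) / 2 := fun i => by
    have := congrFun hy i
    rw [hPdef, hQdef] at this
    simp only [Pi.add_apply, Pi.smul_apply, Pi.sub_apply, smul_eq_mul] at this
    linarith
  have hfrac : ∀ i, z i = 0 ∨ z i = 1 → y₁ i = 0 ∧ y₂ i = 0 ∧ y₃ i = 0 ∧ y₄ i = 0 := by
    intro i hi
    have h1 := hp i
    have h2 := hr i
    rcases hi with hz | hz <;>
    rcases c₁ i with a | a <;> rcases c₂ i with b | b <;> rcases c₃ i with c | c <;>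
      rcases c₄ i with d | d <;> rw [a, b, c, d, hz] at h2 <;> rw [a, c, d, hz] at h1 <;>
      rw [a, b, c, d, hz] <;>
      first
      | (norm_num; done)
      | (exfalso; linarith)
      | (exfalso; exact hξ0 (by linarith))
      | (exfalso; exact hξ1 (by linarith))
  refine ⟨⟨fun i hi => (hfrac i hi).1, fun i hi => (hfrac i hi).2.1,
    fun i hi => (hfrac i hi).2.2.1, fun i hi => (hfrac i hi).2.2.2⟩, ?_⟩
  have : halfDefect z = (2 * ξ - 1) • P := by
    funext i
    simp only [halfDefect, hPdef, Pi.smul_apply, Pi.sub_apply, smul_eq_mul]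
    split_ifs with hi
    · rw [(hfrac i hi).1, (hfrac i hi).2.2.1, sub_zero, mul_zero]
    · have h1 := hp i
      have h2 := hr i
      rcases c₁ i with a | a <;> rcases c₂ i with b | b <;> rcases c₃ i with c | c <;>
        rcases c₄ i with d | d <;> rw [a, b, c, d] at h2 <;> rw [a, c, d] at h1 <;>
        rw [a, c] <;>
        first
        | (exfalso; linarith)
        | linarith
        | (exfalso; exact hi (Or.inl (by linarith)))
        | (exfalso; exact hi (Or.inr (by linarith)))
  rw [this]
  exact Y.smul_mem _ hPY

/-- An orthogonal pentagon `y₀, …, y₄` of cube vertices in dimension three such that `y₁, …, y₄`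
form a parallelogram whose diagonals are the orthogonal pairs `y₁, y₂` and `y₃, y₄`. -/
lemma sub_mem_fracSupported_of_add_eq_add_consecutive (Y : Submodule ℝ (ι → ℝ))
    (hY : finrank ℝ Y ≤ 3) {y₀ y₁ y₂ y₃ y₄ : ι → ℝ} (h₀ : y₀ ∈ Y) (h₂ : y₂ ∈ Y) (h₃ : y₃ ∈ Y)
    (h₄ : y₄ ∈ Y) (c₀ : IsCubeVertexFrom z y₀) (c₁ : IsCubeVertexFrom z y₁)
    (c₂ : IsCubeVertexFrom z y₂) (c₃ : IsCubeVertexFrom z y₃) (c₄ : IsCubeVertexFrom z y₄)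
    (o₂ : z ⬝ᵥ y₂ = 0) (o₄ : z ⬝ᵥ y₄ = 0)
    (h01 : y₀ ⬝ᵥ y₁ = 0) (h12 : y₁ ⬝ᵥ y₂ = 0) (h23 : y₂ ⬝ᵥ y₃ = 0) (h34 : y₃ ⬝ᵥ y₄ = 0)
    (h40 : y₀ ⬝ᵥ y₄ = 0) (h02 : y₀ ⬝ᵥ y₂ ≠ 0) (hrel : y₁ + y₂ = y₃ + y₄) :
    y₂ - y₃ ∈ fracSupported z := by
  have hr : ∀ i, y₁ i + y₂ i = y₃ i + y₄ i := fun i => congrFun hrel i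
  have h03 : y₀ ⬝ᵥ y₃ = y₀ ⬝ᵥ y₂ := by
    have := congrArg (fun u => y₀ ⬝ᵥ u) hrel
    simp only [dotProduct_add] at this
    linarith
  have h24 : y₂ ⬝ᵥ y₄ = y₂ ⬝ᵥ y₂ := by
    have := congrArg (fun u => y₂ ⬝ᵥ u) hrel
    simp only [dotProduct_add] at this
    rw [dotProduct_comm y₂ y₁, h12] at this
    linarith
  have p2 : 0 < y₂ ⬝ᵥ y₂ :=
    dotProduct_self_pos_of_dotProduct_ne_zero (by rwa [dotProduct_comm])
  have p3 : 0 < y₃ ⬝ᵥ y₃ :=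
    dotProduct_self_pos_of_dotProduct_ne_zero (w := y₀) (by rwa [dotProduct_comm, h03])
  have hne : y₄ ≠ y₂ := fun h => h02 (h ▸ h40)
  obtain ⟨E, hE⟩ : ∃ E, E = y₄ - y₂ := ⟨_, rfl⟩
  have pE : 0 < E ⬝ᵥ E := hE ▸ dotProduct_self_pos_of_ne hne
  have hEY : E ∈ Y := hE ▸ Y.sub_mem h₄ h₂
  have h2E : y₂ ⬝ᵥ E = 0 := by rw [hE, dotProduct_sub, h24, sub_self]
  have h3E : y₃ ⬝ᵥ E = 0 := by
    rw [hE, dotProduct_sub, h34, dotProduct_comm, h23, sub_self]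
  have h0E : y₀ ⬝ᵥ E = - (y₀ ⬝ᵥ y₂) := by rw [hE, dotProduct_sub, h40, zero_sub]
  have oE : z ⬝ᵥ E = 0 := by rw [hE, dotProduct_sub, o₂, o₄, sub_zero]
  -- the second set is contained in the fourth one
  have hsub : ∀ i, 0 ≤ E i := by
    have hs : (y₂ + z) ⬝ᵥ E = 0 := by rw [add_dotProduct, h2E, oE, add_zero]
    have hterm : ∀ i, (y₂ i + z i) * E i ≤ 0 := fun i => by
      rw [hE, Pi.sub_apply]
      rcases c₂ i with b | b <;> rcases c₄ i with d | d <;> rw [b, d] <;> linarith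
    have hz : ∀ i, (y₂ i + z i) * E i = 0 := fun i => by
      have := (Finset.sum_eq_zero_iff_of_nonpos fun i _ => hterm i).1 hs i (Finset.mem_univ i)
      exact this
    intro i
    have := hz i
    rw [hE, Pi.sub_apply] at this ⊢
    rcases c₂ i with b | b <;> rcases c₄ i with d | d <;> rw [b, d] at this ⊢ <;> linarith
  have he : 0 < y₀ ⬝ᵥ E := by
    refine lt_of_le_of_ne ?_ (by rw [h0E]; exact (neg_ne_zero.2 h02).symm)
    have h1 : 0 ≤ (y₀ + z) ⬝ᵥ E := Finset.sum_nonneg fun i _ => mul_nonneg (by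
      rw [Pi.add_apply]
      rcases c₀ i with b | b <;> rw [b] <;> linarith) (hsub i)
    rwa [add_dotProduct, oE, add_zero] at h1
  obtain ⟨e, hedef⟩ : ∃ e, e = y₀ ⬝ᵥ E := ⟨_, rfl⟩
  rw [← hedef] at h0E he
  have h02' : y₀ ⬝ᵥ y₂ = - e := by linarith
  -- `y₂`, `y₃`, `E` is an orthogonal basis, in which `y₀` can be expanded
  have hg : y₀ + (e / (y₂ ⬝ᵥ y₂)) • y₂ + (e / (y₃ ⬝ᵥ y₃)) • y₃ - (e / (E ⬝ᵥ E)) • E = 0 := by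
    refine eq_zero_of_dotProduct_orthogonal_three Y hY h₂ h₃ hEY (Y.sub_mem (Y.add_mem
      (Y.add_mem h₀ (Y.smul_mem _ h₂)) (Y.smul_mem _ h₃)) (Y.smul_mem _ hEY)) p2 p3 pE h23 h2E
      h3E ?_ ?_ ?_ <;>
    simp only [sub_dotProduct, add_dotProduct, smul_dotProduct, smul_eq_mul]
    · rw [div_mul_cancel₀ _ p2.ne', dotProduct_comm y₃ y₂, h23, dotProduct_comm E y₂, h2E, h02']
      ring
    · rw [div_mul_cancel₀ _ p3.ne', h23, dotProduct_comm E y₃, h3E, h03, h02']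
      ring
    · rw [div_mul_cancel₀ _ pE.ne', h2E, h3E, ← hedef]
      ring
  have q2 : 0 < e / (y₂ ⬝ᵥ y₂) := by positivity
  have q3 : 0 < e / (y₃ ⬝ᵥ y₃) := by positivity
  generalize e / (y₂ ⬝ᵥ y₂) = s at hg q2
  generalize e / (y₃ ⬝ᵥ y₃) = t at hg q3
  generalize e / (E ⬝ᵥ E) = u at hg
  intro i hi
  have h1 := congrFun hg i
  have h2 := hr i
  rw [hE] at h1
  simp only [Pi.add_apply, Pi.sub_apply, Pi.smul_apply, smul_eq_mul, Pi.zero_apply] at h1 ⊢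
  rcases hi with hz | hz <;> rcases c₀ i with a | a <;> rcases c₁ i with b | b <;>
    rcases c₂ i with c | c <;> rcases c₃ i with d | d <;> rcases c₄ i with f | f <;>
    rw [b, c, d, f, hz] at h2 <;> rw [a, c, d, f, hz] at h1 <;> rw [c, d] <;> linarith

/-- An orthogonal pentagon `y₀, …, y₄` of cube vertices in dimension three such that `y₁, …, y₄`
form a parallelogram whose diagonals are the pairs `y₁, y₃` and `y₂, y₄`. -/
lemma sub_mem_fracSupported_of_add_eq_add_alternate (Y : Submodule ℝ (ι → ℝ))
    (hY : finrank ℝ Y ≤ 3) {y₀ y₁ y₂ y₃ y₄ : ι → ℝ} (h₀ : y₀ ∈ Y) (h₁ : y₁ ∈ Y) (h₂ : y₂ ∈ Y)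
    (h₃ : y₃ ∈ Y) (c₀ : IsCubeVertexFrom z y₀) (c₁ : IsCubeVertexFrom z y₁)
    (c₂ : IsCubeVertexFrom z y₂) (c₃ : IsCubeVertexFrom z y₃) (c₄ : IsCubeVertexFrom z y₄)
    (h01 : y₀ ⬝ᵥ y₁ = 0) (h12 : y₁ ⬝ᵥ y₂ = 0) (h23 : y₂ ⬝ᵥ y₃ = 0) (h34 : y₃ ⬝ᵥ y₄ = 0)
    (h40 : y₀ ⬝ᵥ y₄ = 0) (h02 : y₀ ⬝ᵥ y₂ ≠ 0) (hrel : y₁ + y₃ = y₂ + y₄) :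
    y₂ - y₃ ∈ fracSupported z := by
  have hr : ∀ i, y₁ i + y₃ i = y₂ i + y₄ i := fun i => congrFun hrel i
  have h03 : y₀ ⬝ᵥ y₃ = y₀ ⬝ᵥ y₂ := by
    have := congrArg (fun u => y₀ ⬝ᵥ u) hrel
    simp only [dotProduct_add] at this
    linarith
  have h13 : y₁ ⬝ᵥ y₃ = - (y₃ ⬝ᵥ y₃) := by
    have := congrArg (fun u => u ⬝ᵥ y₃) hrel
    simp only [add_dotProduct] at this
    rw [h23, dotProduct_comm y₄, h34] at this
    linarith
  have h22 : y₂ ⬝ᵥ y₂ = y₃ ⬝ᵥ y₃ := by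
    have : (y₂ - y₁) ⬝ᵥ (y₂ - y₃) = 0 := Finset.sum_eq_zero fun i _ => by
      have := hr i
      simp only [Pi.sub_apply]
      rcases c₁ i with b | b <;> rcases c₂ i with c | c <;> rcases c₃ i with d | d <;>
        rcases c₄ i with f | f <;> rw [b, c, d, f] at this <;> rw [b, c, d] <;>
        first | (exfalso; linarith) | ring
    simp only [sub_dotProduct, dotProduct_sub] at this
    linarith
  have p2 : 0 < y₂ ⬝ᵥ y₂ :=
    dotProduct_self_pos_of_dotProduct_ne_zero (by rwa [dotProduct_comm])
  have p3 : 0 < y₃ ⬝ᵥ y₃ := h22 ▸ p2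
  obtain ⟨s, hs⟩ : ∃ s, s = y₁ + y₃ := ⟨_, rfl⟩
  have h0s : y₀ ⬝ᵥ s = y₀ ⬝ᵥ y₂ := by rw [hs, dotProduct_add, h01, h03, zero_add]
  have ps : 0 < s ⬝ᵥ s := dotProduct_self_pos_of_dotProduct_ne_zero (w := y₀) (by
    rwa [dotProduct_comm, h0s])
  have hsY : s ∈ Y := hs ▸ Y.add_mem h₁ h₃
  have h2s : y₂ ⬝ᵥ s = 0 := by rw [hs, dotProduct_add, h23, dotProduct_comm, h12, zero_add]
  have h3s : y₃ ⬝ᵥ s = 0 := by rw [hs, dotProduct_add, dotProduct_comm, h13, neg_add_cancel]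
  obtain ⟨m, hm⟩ : ∃ m, m = y₀ ⬝ᵥ y₂ := ⟨_, rfl⟩
  rw [← hm] at h03 h0s h02
  -- `y₂`, `y₃`, `s` is an orthogonal basis, in which `y₀` can be expanded
  have hg : y₀ - (m / (y₂ ⬝ᵥ y₂)) • y₂ - (m / (y₂ ⬝ᵥ y₂)) • y₃ - (m / (s ⬝ᵥ s)) • s = 0 := by
    refine eq_zero_of_dotProduct_orthogonal_three Y hY h₂ h₃ hsY (Y.sub_mem (Y.sub_mem
      (Y.sub_mem h₀ (Y.smul_mem _ h₂)) (Y.smul_mem _ h₃)) (Y.smul_mem _ hsY)) p2 p3 ps h23 h2s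
      h3s ?_ ?_ ?_ <;>
    simp only [sub_dotProduct, smul_dotProduct, smul_eq_mul]
    · rw [div_mul_cancel₀ _ p2.ne', dotProduct_comm y₃ y₂, h23, dotProduct_comm s y₂, h2s, ← hm]
      ring
    · rw [← h22, div_mul_cancel₀ _ p2.ne', h23, dotProduct_comm s y₃, h3s, h03]
      ring
    · rw [div_mul_cancel₀ _ ps.ne', h2s, h3s, h0s]
      ring
  obtain ⟨ρ, hρ⟩ : ∃ ρ, ρ = m / (y₂ ⬝ᵥ y₂) + m / (s ⬝ᵥ s) := ⟨_, rfl⟩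
  have hρ0 : ρ ≠ 0 := by
    rw [hρ, div_add_div _ _ p2.ne' ps.ne', ← mul_comm m, ← mul_add]
    exact div_ne_zero (mul_ne_zero h02 (by positivity)) (by positivity)
  have hdiff : ∀ i, y₂ i ≠ y₃ i → y₁ i = y₂ i ∧ y₂ i + y₃ i = 1 - 2 * z i ∧
      y₀ i = ρ * (1 - 2 * z i) := by
    intro i hi
    have h1 := congrFun hg i
    have h2 := hr i
    have hsi : s i = y₁ i + y₃ i := congrFun hs i
    simp only [Pi.sub_apply, Pi.smul_apply, smul_eq_mul, Pi.zero_apply] at h1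
    rw [hsi] at h1
    have h12 : y₁ i = y₂ i := by
      rcases c₁ i with b | b <;> rcases c₂ i with c | c <;> rcases c₃ i with d | d <;>
        rcases c₄ i with f | f <;> rw [b, c, d, f] at h2 <;> rw [c, d] at hi <;> rw [b, c] <;>
        first | (exfalso; linarith) | (exfalso; exact hi rfl)
    have h123 : y₂ i + y₃ i = 1 - 2 * z i := by
      rcases c₂ i with c | c <;> rcases c₃ i with d | d <;> rw [c, d] at hi ⊢ <;>
        first | linarith | (exfalso; exact hi rfl)
    refine ⟨h12, h123, ?_⟩
    rw [← h123, hρ]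
    rw [h12] at h1
    linarith
  intro i hi
  by_contra hne
  have hne' : y₂ i ≠ y₃ i := fun h => hne (by rw [Pi.sub_apply, h, sub_self])
  -- a Boolean coordinate where `y₂` and `y₃` differ forces `ρ = 1`, and then all of them are
  -- Boolean
  have hρ1 : ρ = 1 := by
    have h1 := (hdiff i hne').2.2
    rcases hi with hz | hz <;> rcases c₀ i with a | a <;> rw [a, hz] at h1 <;>
      first
      | linarith
      | (exfalso; exact hρ0 (by linarith))
  have hprod : ∀ j, y₂ j ≠ y₃ j → y₂ j * y₃ j = 0 := by
    intro j hj
    have h1 := (hdiff j hj).2.2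
    rw [hρ1] at h1
    have hz : z j = 0 ∨ z j = 1 := by
      rcases c₀ j with a | a <;> rw [a] at h1
      · right; linarith
      · left; linarith
    rcases hz with hz | hz <;> rcases c₂ j with c | c <;> rcases c₃ j with d | d <;>
      rw [c, d] at hj ⊢ <;> rw [hz] <;> first | (exfalso; exact hj rfl) | norm_num
  have hoff : ∀ j, y₂ j = y₃ j → y₂ j = 0 := by
    have hterm : ∀ j, 0 ≤ y₂ j * y₃ j := fun j => by
      by_cases hj : y₂ j = y₃ j
      · rw [hj]; exact mul_self_nonneg _
      · rw [hprod j hj]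
    intro j hj
    have := (Finset.sum_eq_zero_iff_of_nonneg fun j _ => hterm j).1 h23 j (Finset.mem_univ j)
    rw [← hj] at this
    exact mul_self_eq_zero.1 this
  have hsq : ∀ j, y₁ j * y₂ j = y₂ j * y₂ j := fun j => by
    by_cases hj : y₂ j = y₃ j
    · rw [hoff j hj, mul_zero, mul_zero]
    · rw [(hdiff j hj).1]
  have : y₂ ⬝ᵥ y₂ = 0 := by
    rw [← h12]
    exact Finset.sum_congr rfl fun j _ => (hsq j).symm
  exact p2.ne' this

/-- In a bipyramid `a + b + c = q + 2 o` of cube vertices, at most one of `a`, `b`, `c` differs from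
`o` in any given coordinate. -/
lemma sub_dotProduct_sub_eq_zero_of_bipyramid {o q a b c : ι → ℝ} (co : IsCubeVertexFrom z o)
    (cq : IsCubeVertexFrom z q) (ca : IsCubeVertexFrom z a) (cb : IsCubeVertexFrom z b)
    (cc : IsCubeVertexFrom z c) (h : ∀ i, a i + b i + c i = q i + 2 * o i) :
    (a - o) ⬝ᵥ (b - o) = 0 := Finset.sum_eq_zero fun i _ => by
  have := h i
  simp only [Pi.sub_apply]
  rcases co i with e | e <;> rcases cq i with f | f <;> rcases ca i with g | g <;>
    rcases cb i with k | k <;> rcases cc i with l | l <;> rw [e, f, g, k, l] at this <;>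
    rw [e, g, k] <;> first | (exfalso; linarith) | ring

/-- The five vertices of an orthogonal pentagon do not form a bipyramid `a + b + c = q + 2 o` with
`o` and `q` orthogonal. -/
lemma false_of_bipyramid_orthogonal {y₀ y₁ y₂ y₃ y₄ : ι → ℝ} (c₀ : IsCubeVertexFrom z y₀)
    (c₁ : IsCubeVertexFrom z y₁) (c₂ : IsCubeVertexFrom z y₂) (c₃ : IsCubeVertexFrom z y₃)
    (c₄ : IsCubeVertexFrom z y₄) (h01 : y₀ ⬝ᵥ y₁ = 0) (h23 : y₂ ⬝ᵥ y₃ = 0)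
    (h40 : y₀ ⬝ᵥ y₄ = 0) (h02 : y₀ ⬝ᵥ y₂ ≠ 0)
    (hrel : ∀ i, y₂ i + y₃ i + y₄ i = y₁ i + 2 * y₀ i) : False := by
  have h1 := sub_dotProduct_sub_eq_zero_of_bipyramid c₀ c₁ c₂ c₃ c₄ hrel
  simp only [sub_dotProduct, dotProduct_sub] at h1
  have h2 : y₀ ⬝ᵥ (y₂ + y₃ + y₄) = y₀ ⬝ᵥ (y₁ + (2 : ℝ) • y₀) := by
    congr 1
    funext i
    simpa using hrel i
  simp only [dotProduct_add, dotProduct_smul, smul_eq_mul] at h2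
  rw [dotProduct_comm y₂ y₀] at h1
  linarith [dotProduct_self_pos_of_dotProduct_ne_zero h02]

/-- The five vertices of an orthogonal pentagon do not form a bipyramid `a + b + c = q + 2 o` with
`o` and `q` not orthogonal. -/
lemma false_of_bipyramid_not_orthogonal {y₀ y₁ y₂ y₃ y₄ : ι → ℝ} (c₀ : IsCubeVertexFrom z y₀)
    (c₁ : IsCubeVertexFrom z y₁) (c₂ : IsCubeVertexFrom z y₂) (c₃ : IsCubeVertexFrom z y₃)
    (c₄ : IsCubeVertexFrom z y₄) (h01 : y₀ ⬝ᵥ y₁ = 0) (h34 : y₃ ⬝ᵥ y₄ = 0)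
    (h40 : y₀ ⬝ᵥ y₄ = 0) (h13 : y₁ ⬝ᵥ y₃ ≠ 0)
    (hrel : ∀ i, y₁ i + y₃ i + y₄ i = y₂ i + 2 * y₀ i) : False := by
  have h1 := sub_dotProduct_sub_eq_zero_of_bipyramid c₀ c₂ c₁ c₃ c₄ hrel
  have h2 := sub_dotProduct_sub_eq_zero_of_bipyramid c₀ c₂ c₃ c₄ c₁ fun i => by
    linarith [hrel i]
  simp only [sub_dotProduct, dotProduct_sub] at h1 h2
  rw [dotProduct_comm y₃ y₀] at h2
  rw [dotProduct_comm y₁ y₀] at h1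
  exact h13 (by linarith)

/-- Four cube vertices spanning dimension two as seen from `z`, whose only orthogonal pairs are
`y₁, y₃` and `y₂, y₄`: they are supported on the fractional coordinates of `z`, their span contains
`halfDefect z`, and two of the sets cover the other two. -/
lemma quad_structure (Y : Submodule ℝ (ι → ℝ)) (hY : finrank ℝ Y ≤ 2) {y₁ y₂ y₃ y₄ : ι → ℝ}
    (h₁ : y₁ ∈ Y) (h₂ : y₂ ∈ Y) (h₃ : y₃ ∈ Y) (h₄ : y₄ ∈ Y)
    (c₁ : IsCubeVertexFrom z y₁) (c₂ : IsCubeVertexFrom z y₂) (c₃ : IsCubeVertexFrom z y₃)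
    (c₄ : IsCubeVertexFrom z y₄)
    (o₁ : z ⬝ᵥ y₁ = 0) (o₂ : z ⬝ᵥ y₂ = 0) (o₃ : z ⬝ᵥ y₃ = 0) (o₄ : z ⬝ᵥ y₄ = 0)
    (n12 : y₁ ≠ y₂) (n13 : y₁ ≠ y₃) (n14 : y₁ ≠ y₄) (n23 : y₂ ≠ y₃) (n24 : y₂ ≠ y₄)
    (n34 : y₃ ≠ y₄)
    (h13 : y₁ ⬝ᵥ y₃ = 0) (h24 : y₂ ⬝ᵥ y₄ = 0) (h12 : y₁ ⬝ᵥ y₂ ≠ 0) (h32 : y₃ ⬝ᵥ y₂ ≠ 0)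
    (h14 : y₁ ⬝ᵥ y₄ ≠ 0) (h34 : y₃ ⬝ᵥ y₄ ≠ 0) :
    ((y₁ ∈ fracSupported z ∧ y₂ ∈ fracSupported z ∧ y₃ ∈ fracSupported z ∧
      y₄ ∈ fracSupported z) ∧ halfDefect z ∈ Y) ∧
    ((∀ i, y₁ i = - z i → y₂ i = - z i → y₃ i = - z i ∧ y₄ i = - z i) ∨
      (∀ i, y₁ i = - z i → y₄ i = - z i → y₂ i = - z i ∧ y₃ i = - z i)) := by
  obtain ⟨α, ⟨j, hj⟩, hsum, hα⟩ : ∃ α : Fin 4 → ℝ, (∃ j, α j ≠ 0) ∧ ∑ j, α j = 0 ∧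
      ∀ i, ∑ j, α j * (![y₁ + z, y₂ + z, y₃ + z, y₄ + z] : Fin 4 → ι → ℝ) j i = 0 :=
    exists_affine_relation (z := z) _ Y (by omega : finrank ℝ Y < 3)
    (by simp [Fin.forall_fin_succ, h₁, h₂, h₃, h₄])
  simp only [Fin.sum_univ_four] at hsum hα
  have add_ne : ∀ {a b : ι → ℝ}, a ≠ b → a + z ≠ b + z := fun h h' => h (add_right_cancel h')
  have hpar := parallelogram_of_cube_relation (α := α 0) (β := α 1) (γ := α 2) (δ := α 3)
    c₁.add_mem c₂.add_mem c₃.add_mem c₄.add_mem (add_ne n12) (add_ne n13) (add_ne n14)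
    (add_ne n23) (add_ne n24) (add_ne n34)
    (fun h => hj (by fin_cases j; exacts [h.1, h.2.1, h.2.2.1, h.2.2.2])) hsum (fun i => by
      simpa using hα i)
  have cancel : ∀ {a b c d : ι → ℝ}, a + z + (b + z) = c + z + (d + z) → a + b = c + d := by
    intro a b c d h
    funext i
    have := congrFun h i
    simp only [Pi.add_apply] at this ⊢
    linarith
  have cover : ∀ {a b c d : ι → ℝ}, IsCubeVertexFrom z c → IsCubeVertexFrom z d →
      a + b = c + d → ∀ i, a i = - z i → b i = - z i → c i = - z i ∧ d i = - z i := by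
    intro a b c d hc hd h i ha hb
    have := congrFun h i
    simp only [Pi.add_apply] at this
    rcases hc i with hc | hc <;> rcases hd i with hd | hd <;>
      first | exact ⟨hc, hd⟩ | (exfalso; linarith)
  rcases hpar with hp | hp | hp
  · have hp := cancel hp
    exact ⟨fracSupported_of_parallelogram_orthogonal_sides Y hY h₁ h₃ h₄ c₁ c₂ c₃ c₄ n13 n14 h13
      h24 hp, Or.inl (cover c₃ c₄ hp)⟩
  · exact (false_of_parallelogram_orthogonal_diagonals Y hY h₁ h₃ h₄ c₁ c₂ c₃ c₄ o₁ o₂ o₃ o₄ h13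
      h24 h12 h32 h14 h34 (cancel hp)).elim
  · have hp := (cancel hp).trans (add_comm _ _)
    have := fracSupported_of_parallelogram_orthogonal_sides Y hY h₁ h₃ h₂ c₁ c₄ c₃ c₂ n13 n12 h13
      (by rwa [dotProduct_comm]) hp
    exact ⟨⟨⟨this.1.1, this.1.2.2.2, this.1.2.2.1, this.1.2.1⟩, this.2⟩,
      Or.inr fun i ha hb => (cover c₃ c₂ hp i ha hb).symm⟩

/-- An orthogonal pentagon of cube vertices in dimension three, of which four form a parallelogram:
the span contains a nonzero vector supported on the fractional coordinates of `z`, and three of the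
sets cover the other two. -/
lemma pentagon_structure_of_parallelogram (Y : Submodule ℝ (ι → ℝ)) (hY : finrank ℝ Y ≤ 3)
    (y : Fin 5 → ι → ℝ) (hyY : ∀ j, y j ∈ Y) (hc : ∀ j, IsCubeVertexFrom z (y j))
    (ho : ∀ j, z ⬝ᵥ y j = 0) (hinj : Function.Injective y) (h0 : ∀ j, y j ⬝ᵥ y (j + 1) = 0)
    (h1 : ∀ j, y j ⬝ᵥ y (j + 2) ≠ 0)
    (hpar : y 1 + y 2 = y 3 + y 4 ∨ y 1 + y 3 = y 2 + y 4 ∨ y 1 + y 4 = y 2 + y 3) :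
    (∃ g ∈ Y, g ≠ 0 ∧ g ∈ fracSupported z) ∧
      ∃ a b c, ∀ i, y a i = - z i → y b i = - z i → y c i = - z i → ∀ j, y j i = - z i := by
  have hne : y 2 - y 3 ≠ 0 := fun h => absurd (hinj (sub_eq_zero.1 h)) (by decide)
  have h40 : y 0 ⬝ᵥ y 4 = 0 := by rw [dotProduct_comm]; exact h0 4
  rcases hpar with h | h | h
  · refine ⟨⟨y 2 - y 3, Y.sub_mem (hyY 2) (hyY 3), hne,
      sub_mem_fracSupported_of_add_eq_add_consecutive Y hY (hyY 0) (hyY 2) (hyY 3) (hyY 4) (hc 0)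
        (hc 1) (hc 2) (hc 3) (hc 4) (ho 2) (ho 4) (h0 0) (h0 1) (h0 2) (h0 3) h40 (h1 0) h⟩,
      0, 1, 2, ?_⟩
    intro i e0 e1 e2
    have hi := congrFun h i
    simp only [Pi.add_apply] at hi
    have : y 3 i = - z i ∧ y 4 i = - z i := by
      rcases hc 3 i with a | a <;> rcases hc 4 i with b | b <;>
        first | exact ⟨a, b⟩ | (exfalso; linarith)
    intro j
    fin_cases j
    exacts [e0, e1, e2, this.1, this.2]
  · refine ⟨⟨y 2 - y 3, Y.sub_mem (hyY 2) (hyY 3), hne,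
      sub_mem_fracSupported_of_add_eq_add_alternate Y hY (hyY 0) (hyY 1) (hyY 2) (hyY 3) (hc 0)
        (hc 1) (hc 2) (hc 3) (hc 4) (h0 0) (h0 1) (h0 2) (h0 3) h40 (h1 0) h⟩,
      0, 1, 3, ?_⟩
    intro i e0 e1 e2
    have hi := congrFun h i
    simp only [Pi.add_apply] at hi
    have : y 2 i = - z i ∧ y 4 i = - z i := by
      rcases hc 2 i with a | a <;> rcases hc 4 i with b | b <;>
        first | exact ⟨a, b⟩ | (exfalso; linarith)
    intro j
    fin_cases j
    exacts [e0, e1, this.1, e2, this.2]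
  · refine absurd ?_ (h1 4)
    have e : (y 1 + z) ⬝ᵥ (y 4 + z) = (y 2 + z) ⬝ᵥ (y 3 + z) := Finset.sum_congr rfl fun i _ => by
      have hi := congrFun h i
      simp only [Pi.add_apply] at hi ⊢
      rcases hc 1 i with a | a <;> rcases hc 2 i with b | b <;> rcases hc 3 i with c | c <;>
        rcases hc 4 i with d | d <;> rw [a, b, c, d] at hi <;> rw [a, b, c, d] <;>
        first | (exfalso; linarith) | ring
    simp only [add_dotProduct, dotProduct_add, ho, dotProduct_comm _ z] at e
    have h23 : y 2 ⬝ᵥ y 3 = 0 := h0 2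
    show y 4 ⬝ᵥ y 1 = 0
    rw [dotProduct_comm]
    linarith

/-- Five cube vertices spanning dimension three as seen from `z`, whose orthogonal pairs form a
pentagon: the span contains a nonzero vector supported on the fractional coordinates of `z`, and
three of the sets cover the other two. -/
lemma pentagon_structure (Y : Submodule ℝ (ι → ℝ)) (hY : finrank ℝ Y ≤ 3)
    (y : Fin 5 → ι → ℝ) (hyY : ∀ j, y j ∈ Y) (hc : ∀ j, IsCubeVertexFrom z (y j))
    (ho : ∀ j, z ⬝ᵥ y j = 0) (hinj : Function.Injective y) (h0 : ∀ j, y j ⬝ᵥ y (j + 1) = 0)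
    (h1 : ∀ j, y j ⬝ᵥ y (j + 2) ≠ 0) :
    (∃ g ∈ Y, g ≠ 0 ∧ g ∈ fracSupported z) ∧
      ∃ a b c, ∀ i, y a i = - z i → y b i = - z i → y c i = - z i → ∀ j, y j i = - z i := by
  obtain ⟨α, hα0, hsum, hα⟩ := exists_affine_relation (z := z) (fun j => y j + z) Y
    (by omega : finrank ℝ Y < 4) (by simpa using hyY)
  -- a relation that omits a vertex `p` is a parallelogram; one that involves all of them is a
  -- bipyramid, which cannot occur
  by_cases hp : ∃ p, α p = 0
  · obtain ⟨p, hp⟩ := hp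
    have hnd : [p, p + 1, p + 2, p + 3, p + 4].Nodup := by clear hp; revert p; decide
    rw [sum_fin_five _ hnd, hp] at hsum
    have hα' : ∀ i, α (p + 1) * (y (p + 1) + z) i + α (p + 2) * (y (p + 2) + z) i +
        α (p + 3) * (y (p + 3) + z) i + α (p + 4) * (y (p + 4) + z) i = 0 := fun i => by
      have := hα i
      rw [sum_fin_five _ hnd, hp] at this
      linarith
    have hne : ∀ j k : Fin 5, j ≠ k → y (p + j) + z ≠ y (p + k) + z := fun j k hjk h =>
      hjk (add_left_cancel (hinj (add_right_cancel h)))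
    have hpar := parallelogram_of_cube_relation (hc (p + 1)).add_mem (hc (p + 2)).add_mem
      (hc (p + 3)).add_mem (hc (p + 4)).add_mem (hne 1 2 (by decide)) (hne 1 3 (by decide))
      (hne 1 4 (by decide)) (hne 2 3 (by decide)) (hne 2 4 (by decide)) (hne 3 4 (by decide))
      (fun h => by
        obtain ⟨j, hj⟩ := hα0
        have : j = p ∨ j = p + 1 ∨ j = p + 2 ∨ j = p + 3 ∨ j = p + 4 := by
          clear hj h hne hα' hsum hnd hp
          revert j p; decide
        rcases this with rfl | rfl | rfl | rfl | rfl
        exacts [hj hp, hj h.1, hj h.2.1, hj h.2.2.1, hj h.2.2.2]) (by linarith) hα'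
    have cancel : ∀ {a b c d : ι → ℝ}, a + z + (b + z) = c + z + (d + z) → a + b = c + d := by
      intro a b c d h
      funext i
      have := congrFun h i
      simp only [Pi.add_apply] at this ⊢
      linarith
    obtain ⟨hg, a, b, c, habc⟩ := pentagon_structure_of_parallelogram Y hY (fun j => y (p + j))
      (fun j => hyY _) (fun j => hc _) (fun j => ho _) (hinj.comp (add_right_injective p))
      (fun j => by rw [← add_assoc]; exact h0 _) (fun j => by rw [← add_assoc]; exact h1 _)
      (hpar.imp cancel (Or.imp cancel cancel))
    refine ⟨hg, p + a, p + b, p + c, fun i ha hb hc j => ?_⟩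
    have := habc i ha hb hc (j - p)
    rwa [add_sub_cancel] at this
  · push Not at hp
    obtain ⟨o, q, hoq, hrel⟩ := bipyramid_of_cube_relation (fun j i => (hc j).add_mem i)
      (fun j k h => hinj (add_right_cancel h)) hp hsum hα
    have hnd : [o, o + 1, o + 2, o + 3, o + 4].Nodup := by clear hrel hoq; revert o; decide
    have hq : q = o + 1 ∨ q = o + 2 ∨ q = o + 3 ∨ q = o + 4 := by
      clear hrel hnd; revert o q; decide
    rw [sum_fin_five _ hnd] at hrel
    have hr : ∀ i, y o i + (y (o + 1) i + (y (o + 2) i + (y (o + 3) i + y (o + 4) i))) =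
        2 * y q i + 3 * y o i := fun i => by
      have := congrFun hrel i
      simp only [Pi.add_apply, Pi.smul_apply, smul_eq_mul] at this
      linarith
    have e01 : y o ⬝ᵥ y (o + 1) = 0 := h0 o
    have e12 : y (o + 1) ⬝ᵥ y (o + 2) = 0 := by simpa [add_assoc] using h0 (o + 1)
    have e23 : y (o + 2) ⬝ᵥ y (o + 3) = 0 := by simpa [add_assoc] using h0 (o + 2)
    have e34 : y (o + 3) ⬝ᵥ y (o + 4) = 0 := by simpa [add_assoc] using h0 (o + 3)
    have e40 : y o ⬝ᵥ y (o + 4) = 0 := by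
      rw [dotProduct_comm]; simpa [add_assoc] using h0 (o + 4)
    have f02 : y o ⬝ᵥ y (o + 2) ≠ 0 := h1 o
    have f13 : y (o + 1) ⬝ᵥ y (o + 3) ≠ 0 := by simpa [add_assoc] using h1 (o + 1)
    have f24 : y (o + 2) ⬝ᵥ y (o + 4) ≠ 0 := by simpa [add_assoc] using h1 (o + 2)
    have f03 : y o ⬝ᵥ y (o + 3) ≠ 0 := by
      rw [dotProduct_comm]; simpa [add_assoc] using h1 (o + 3)
    exfalso
    rcases hq with rfl | rfl | rfl | rfl
    · exact false_of_bipyramid_orthogonal (hc o) (hc (o + 1)) (hc (o + 2)) (hc (o + 3))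
        (hc (o + 4)) e01 e23 e40 f02 fun i => by linarith [hr i]
    · exact false_of_bipyramid_not_orthogonal (hc o) (hc (o + 1)) (hc (o + 2)) (hc (o + 3))
        (hc (o + 4)) e01 e34 e40 f13 fun i => by linarith [hr i]
    · exact false_of_bipyramid_not_orthogonal (hc o) (hc (o + 4)) (hc (o + 3)) (hc (o + 2))
        (hc (o + 1)) e40 (by rwa [dotProduct_comm]) e01 (by rwa [dotProduct_comm])
        fun i => by linarith [hr i]
    · exact false_of_bipyramid_orthogonal (hc o) (hc (o + 4)) (hc (o + 3)) (hc (o + 2))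
        (hc (o + 1)) e40 (by rwa [dotProduct_comm]) e01 f03 fun i => by linarith [hr i]

end Geometry

/-! ### Components with four or five vertices, all of degree two -/

section DegreeTwo

variable {V : Type*} {G : SimpleGraph V}

/-- In a graph of maximum degree two, four vertices of degree two closed under adjacency form a
four-cycle. -/
lemma exists_quad (hdeg : ∀ a b c d, G.Adj a b → G.Adj a c → G.Adj a d → b = c ∨ b = d ∨ c = d)
    {s : Finset V} (hs : s.card = 4)
    (hmin : ∀ a ∈ s, ∃ b ∈ s, ∃ c ∈ s, b ≠ c ∧ G.Adj a b ∧ G.Adj a c) :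
    ∃ a b c d, (∀ x, x ∈ s ↔ x = a ∨ x = b ∨ x = c ∨ x = d) ∧ [a, b, c, d].Nodup ∧
      G.Adj a b ∧ G.Adj b c ∧ G.Adj c d ∧ G.Adj d a ∧ ¬ G.Adj a c ∧ ¬ G.Adj b d := by
  classical
  obtain ⟨a, ha⟩ : s.Nonempty := Finset.card_pos.1 (by omega)
  obtain ⟨b, hb, d, hd, hbd, hab, had⟩ := hmin a ha
  obtain ⟨c, hc, hcn⟩ := Finset.exists_mem_notMem_of_card_lt_card
    (lt_of_le_of_lt (Finset.card_le_three (a := a) (b := b) (c := d)) (by omega : 3 < s.card))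
  simp only [Finset.mem_insert, Finset.mem_singleton, not_or] at hcn
  have hnd : [a, b, c, d].Nodup := by
    simp [hab.ne, had.ne, hbd, Ne.symm hcn.1, Ne.symm hcn.2.1, hcn.2.2]
  have hs' : s = {a, b, c, d} := by
    refine (Finset.eq_of_subset_of_card_le ?_ ?_).symm
    · intro x hx
      simp only [Finset.mem_insert, Finset.mem_singleton] at hx
      rcases hx with rfl | rfl | rfl | rfl <;> assumption
    · have := List.toFinset_card_of_nodup hnd
      simp only [List.toFinset_cons, List.toFinset_nil, List.length_cons, List.length_nil,
        insert_empty_eq] at this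
      rw [this, hs]
  have hac : ¬ G.Adj a c := fun h => by
    rcases hdeg a b d c hab had h with h | h | h
    · exact hbd h
    · exact hcn.2.1 h.symm
    · exact hcn.2.2 h.symm
  have hcb : G.Adj c b ∧ G.Adj c d := by
    obtain ⟨x, hx, y, hy, hxy, hcx, hcy⟩ := hmin c hc
    have mem : ∀ x ∈ s, G.Adj c x → x = b ∨ x = d := fun x hx h => by
      rw [hs'] at hx
      simp only [Finset.mem_insert, Finset.mem_singleton] at hx
      rcases hx with rfl | rfl | rfl | rfl
      · exact absurd h.symm hac
      · exact Or.inl rfl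
      · exact absurd h G.irrefl
      · exact Or.inr rfl
    rcases mem x hx hcx with rfl | rfl <;> rcases mem y hy hcy with rfl | rfl
    · exact absurd rfl hxy
    · exact ⟨hcx, hcy⟩
    · exact ⟨hcy, hcx⟩
    · exact absurd rfl hxy
  refine ⟨a, b, c, d, fun x => by simp [hs'], hnd, hab, hcb.1.symm, hcb.2, had.symm, hac,
    fun h => ?_⟩
  rcases hdeg b a c d hab.symm hcb.1.symm h with h | h | h
  · exact hcn.1 h.symm
  · exact had.ne h
  · exact hcn.2.2 h

/-- In a graph of maximum degree two, five vertices of degree two closed under adjacency form a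
five-cycle; they are listed along the complementary five-cycle. -/
lemma exists_pentagon
    (hdeg : ∀ a b c d, G.Adj a b → G.Adj a c → G.Adj a d → b = c ∨ b = d ∨ c = d)
    {s : Finset V} (hs : s.card = 5)
    (hmin : ∀ a ∈ s, ∃ b ∈ s, ∃ c ∈ s, b ≠ c ∧ G.Adj a b ∧ G.Adj a c) :
    ∃ g : Fin 5 → V, Function.Injective g ∧ (∀ a, a ∈ s ↔ ∃ j, g j = a) ∧
      (∀ j, G.Adj (g j) (g (j + 2))) ∧ ∀ j, ¬ G.Adj (g j) (g (j + 1)) := by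
  classical
  -- every vertex of `s` has a neighbour in `s` other than a prescribed vertex
  have other : ∀ a ∈ s, ∀ b, ∃ c ∈ s, c ≠ b ∧ G.Adj a c := fun a ha b => by
    obtain ⟨x, hx, y, hy, hxy, hax, hay⟩ := hmin a ha
    by_cases h : x = b
    · exact ⟨y, hy, fun h' => hxy (h.trans h'.symm), hay⟩
    · exact ⟨x, hx, h, hax⟩
  -- a vertex with two known neighbours has no others
  have full : ∀ {a b c x}, G.Adj a b → G.Adj a c → b ≠ c → G.Adj a x → x = b ∨ x = c :=
    fun {a b c x} hb hc hbc hx => by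
      rcases hdeg a b c x hb hc hx with h | h | h
      · exact absurd h hbc
      · exact Or.inl h.symm
      · exact Or.inr h.symm
  obtain ⟨a, ha⟩ : s.Nonempty := Finset.card_pos.1 (by omega)
  obtain ⟨b, hb, c, hc, hbc, hab, hac⟩ := hmin a ha
  obtain ⟨d, hd, hda, hbd⟩ := other b hb a
  -- a triangle `a`, `b`, `d` would leave two vertices, too few for a vertex of degree two
  have hdc : d ≠ c := by
    rintro rfl
    obtain ⟨x, hx, hxn⟩ := Finset.exists_mem_notMem_of_card_lt_card
      (lt_of_le_of_lt (Finset.card_le_three (a := a) (b := b) (c := d)) (by omega : 3 < s.card))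
    simp only [Finset.mem_insert, Finset.mem_singleton, not_or] at hxn
    have out : ∀ u, u ∉ ({a, b, d} : Finset V) → ∀ v, G.Adj u v → v ∉ ({a, b, d} : Finset V) := by
      intro u hu v huv hv
      simp only [Finset.mem_insert, Finset.mem_singleton, not_or] at hu hv
      rcases hv with rfl | rfl | rfl
      · rcases full hab hac hbc huv.symm with h | h
        · exact hu.2.1 h
        · exact hu.2.2 h
      · rcases full hab.symm hbd hda.symm huv.symm with h | h
        · exact hu.1 h
        · exact hu.2.2 h
      · rcases full hac.symm hbd.symm hab.ne huv.symm with h | h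
        · exact hu.1 h
        · exact hu.2.1 h
    obtain ⟨y, hy, w, hw, hyw, hxy, hxw⟩ := hmin x hx
    have hxn' : x ∉ ({a, b, d} : Finset V) := by simpa using hxn
    have hyn := out x hxn' y hxy
    have hwn := out x hxn' w hxw
    simp only [Finset.mem_insert, Finset.mem_singleton, not_or] at hyn hwn
    have h6 : [a, b, d, x, y, w].Nodup := by
      simp [hab.ne, hac.ne, hbc, Ne.symm hxn.1, Ne.symm hxn.2.1, Ne.symm hxn.2.2,
        Ne.symm hyn.1, Ne.symm hyn.2.1, Ne.symm hyn.2.2, Ne.symm hwn.1, Ne.symm hwn.2.1,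
        Ne.symm hwn.2.2, hxy.ne, hxw.ne, hyw]
    have hle := Finset.card_le_card (s := [a, b, d, x, y, w].toFinset) (t := s) (by
      intro u hu
      simp only [List.mem_toFinset, List.mem_cons, List.not_mem_nil, or_false] at hu
      rcases hu with rfl | rfl | rfl | rfl | rfl | rfl <;> assumption)
    rw [List.toFinset_card_of_nodup h6] at hle
    simp at hle
    omega
  obtain ⟨e, he, hea, hce⟩ := other c hc a
  have heb : e ≠ b := by
    rintro rfl
    rcases full hab.symm hbd hda.symm hce.symm with h | h
    · exact hac.ne h.symm
    · exact hdc h.symm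
  -- a four-cycle `a`, `b`, `e`, `c` would leave a single vertex
  have hed : e ≠ d := by
    rintro rfl
    have h4 : ({a, b, c, e} : Finset V).card ≤ 4 := Finset.card_le_four
    obtain ⟨x, hx, hxn⟩ := Finset.exists_mem_notMem_of_card_lt_card
      (lt_of_le_of_lt h4 (by omega : 4 < s.card))
    simp only [Finset.mem_insert, Finset.mem_singleton, not_or] at hxn
    have out : ∀ v ∈ ({a, b, c, e} : Finset V), ¬ G.Adj x v := by
      intro v hv h
      simp only [Finset.mem_insert, Finset.mem_singleton] at hv
      rcases hv with rfl | rfl | rfl | rfl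
      · rcases full hab hac hbc h.symm with h | h
        · exact hxn.2.1 h
        · exact hxn.2.2.1 h
      · rcases full hab.symm hbd hda.symm h.symm with h | h
        · exact hxn.1 h
        · exact hxn.2.2.2 h
      · rcases full hac.symm hce hda.symm h.symm with h | h
        · exact hxn.1 h
        · exact hxn.2.2.2 h
      · rcases full hbd.symm hce.symm hbc h.symm with h | h
        · exact hxn.2.1 h
        · exact hxn.2.2.1 h
    obtain ⟨y, hy, w, hw, hyw, hxy, hxw⟩ := hmin x hx
    have hyn : y ∉ ({a, b, c, e} : Finset V) := fun h => out y h hxy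
    simp only [Finset.mem_insert, Finset.mem_singleton, not_or] at hyn
    have h6 : [a, b, c, e, x, y].Nodup := by
      simp [hab.ne, hac.ne, hbc, hbd.ne, hce.ne, Ne.symm hea, Ne.symm hxn.1, Ne.symm hxn.2.1,
        Ne.symm hxn.2.2.1, Ne.symm hxn.2.2.2, Ne.symm hyn.1, Ne.symm hyn.2.1, Ne.symm hyn.2.2.1,
        Ne.symm hyn.2.2.2, hxy.ne]
    have hle := Finset.card_le_card (s := [a, b, c, e, x, y].toFinset) (t := s) (by
      intro u hu
      simp only [List.mem_toFinset, List.mem_cons, List.not_mem_nil, or_false] at hu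
      rcases hu with rfl | rfl | rfl | rfl | rfl | rfl <;> assumption)
    rw [List.toFinset_card_of_nodup h6] at hle
    simp at hle
    omega
  have hnd : [a, d, c, b, e].Nodup := by
    simp [Ne.symm hda, hac.ne, hab.ne, Ne.symm hea, hdc, hbd.ne.symm, Ne.symm hed, hbc.symm,
      hce.ne, Ne.symm heb]
  have hs' : [a, d, c, b, e].toFinset = s := by
    refine Finset.eq_of_subset_of_card_le ?_ ?_
    · intro u hu
      simp only [List.mem_toFinset, List.mem_cons, List.not_mem_nil, or_false] at hu
      rcases hu with rfl | rfl | rfl | rfl | rfl <;> assumption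
    · rw [List.toFinset_card_of_nodup hnd, hs]
      rfl
  have hde : G.Adj d e := by
    obtain ⟨x, hx, hxb, hdx⟩ := other d hd b
    rw [← hs'] at hx
    simp only [List.mem_toFinset, List.mem_cons, List.not_mem_nil, or_false] at hx
    rcases hx with rfl | rfl | rfl | rfl | rfl
    · rcases full hab hac hbc hdx.symm with h | h
      · exact absurd h hbd.ne.symm
      · exact absurd h hdc
    · exact absurd hdx G.irrefl
    · rcases full hac.symm hce (Ne.symm hea) hdx.symm with h | h
      · exact absurd h hda
      · exact absurd h.symm hed
    · exact absurd rfl hxb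
    · exact hdx
  have hinj : Function.Injective ![a, d, c, b, e] := by
    intro j k hjk
    have := (List.nodup_iff_injective_get.1 hnd : _)
    refine this (a₁ := j) (a₂ := k) ?_
    fin_cases j <;> fin_cases k <;> exact hjk
  have hadj : ∀ j : Fin 5, G.Adj (![a, d, c, b, e] j) (![a, d, c, b, e] (j + 2)) := by
    intro j
    fin_cases j
    exacts [hac, hbd.symm, hce, hab.symm, hde.symm]
  refine ⟨![a, d, c, b, e], hinj, fun u => ?_, hadj, fun j hj => ?_⟩
  · rw [← hs']
    simp [Fin.exists_fin_succ, eq_comm]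
  · have h3 : G.Adj (![a, d, c, b, e] j) (![a, d, c, b, e] (j + 3)) := by
      have := (hadj (j + 3)).symm
      rwa [add_assoc, show (3 : Fin 5) + 2 = 0 from rfl, add_zero] at this
    rcases hdeg _ _ _ _ hj (hadj j) h3 with h | h | h
    all_goals
      have := add_left_cancel (hinj h)
      revert this
      decide

end DegreeTwo

/-! ### Connected components and the dimension they span -/

section Components

variable {V : Type*} [Fintype V] {G : SimpleGraph V}

open Classical in
/-- The vertices of a connected component, as a finset. -/
noncomputable def componentFinset (c : G.ConnectedComponent) : Finset V :=
  Finset.univ.filter fun a => G.connectedComponentMk a = c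

lemma mem_componentFinset {c : G.ConnectedComponent} {a : V} :
    a ∈ componentFinset c ↔ G.connectedComponentMk a = c := by
  simp [componentFinset]

lemma componentFinset_nonempty (c : G.ConnectedComponent) : (componentFinset c).Nonempty := by
  obtain ⟨a, rfl⟩ := c.exists_rep
  exact ⟨a, mem_componentFinset.2 rfl⟩

lemma mem_componentFinset_of_adj {c : G.ConnectedComponent} {a b : V}
    (ha : a ∈ componentFinset c) (h : G.Adj a b) : b ∈ componentFinset c := by
  rw [mem_componentFinset] at ha ⊢
  rw [← ha]
  exact SimpleGraph.ConnectedComponent.sound h.symm.reachable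

lemma sum_card_componentFinset [Fintype G.ConnectedComponent] :
    ∑ c : G.ConnectedComponent, (componentFinset c).card = Fintype.card V := by
  classical
  rw [← Finset.card_univ, Finset.card_eq_sum_card_fiberwise
    (f := G.connectedComponentMk) (t := Finset.univ) (fun a _ => Finset.mem_univ _)]
  refine Finset.sum_congr rfl fun c _ => ?_
  congr 1

end Components

section ComponentRank

variable {V : Type*} [Fintype V] {G : SimpleGraph V} {B : V → V → ℝ} {E : Type*} [AddCommGroup E]
  [Module ℝ E] [FiniteDimensional ℝ E] {x : V → E}

/-- Let all linear relations among the vectors `x a` be kernel vectors of a matrix supported on `G`.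
If `T` contains `a` and all but at most one neighbour of `a`, a relation vanishing on `T` vanishes
on the component of `a`, so that the component spans dimension at least its size minus `T.card`. -/
lemma card_component_le_of_forcing {c : G.ConnectedComponent} {a : V}
    (hB0 : ∀ a b, a ≠ b → ¬ G.Adj a b → B a b = 0) (hB1 : ∀ a b, G.Adj a b → B a b ≠ 0)
    (hdeg : ∀ a b c d, G.Adj a b → G.Adj a c → G.Adj a d → b = c ∨ b = d ∨ c = d)
    (hx : ∀ α : V → ℝ, ∑ a, α a • x a = 0 → ∀ a, ∑ b, B a b * α b = 0)
    (ha : a ∈ componentFinset c) (T : Finset V) (haT : a ∈ T)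
    (hT : ∀ b d, G.Adj a b → G.Adj a d → d ∉ T → b ∉ T → b = d) :
    (componentFinset c).card ≤
      finrank ℝ (Submodule.span ℝ (x '' componentFinset c)) + T.card := by
  classical
  refine card_le_finrank_span_add_card x _ T fun α hsupp hα hαT => ?_
  have hker := hx α hα
  funext b
  by_cases hb : b ∈ componentFinset c
  · refine eq_zero_of_reachable hB0 hB1 hdeg hker ?_ (hαT a haT) fun d had => ?_
    · rw [mem_componentFinset] at ha hb
      exact SimpleGraph.ConnectedComponent.exact (ha.trans hb.symm)
    by_cases hd : d ∈ T
    · exact hαT d hd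
    refine eq_zero_of_forall_adj_ne hB0 hB1 hker had (hαT a haT) fun e hae hed => ?_
    by_cases he : e ∈ T
    · exact hαT e he
    · exact absurd (hT e d hae had hd he) hed
  · exact hsupp b hb

lemma card_component_le_add_two (hB0 : ∀ a b, a ≠ b → ¬ G.Adj a b → B a b = 0)
    (hB1 : ∀ a b, G.Adj a b → B a b ≠ 0)
    (hdeg : ∀ a b c d, G.Adj a b → G.Adj a c → G.Adj a d → b = c ∨ b = d ∨ c = d)
    (hx : ∀ α : V → ℝ, ∑ a, α a • x a = 0 → ∀ a, ∑ b, B a b * α b = 0)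
    (c : G.ConnectedComponent) :
    (componentFinset c).card ≤ finrank ℝ (Submodule.span ℝ (x '' componentFinset c)) + 2 := by
  classical
  obtain ⟨a, ha⟩ := componentFinset_nonempty c
  by_cases hb : ∃ b, G.Adj a b
  · obtain ⟨b, hb⟩ := hb
    refine (card_component_le_of_forcing hB0 hB1 hdeg hx ha {a, b} (by simp) ?_).trans
      (Nat.add_le_add_left Finset.card_le_two _)
    intro d e hd he heT hdT
    simp only [Finset.mem_insert, Finset.mem_singleton, not_or] at heT hdT
    rcases hdeg a b d e hb hd he with h | h | h
    · exact absurd h.symm hdT.2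
    · exact absurd h.symm heT.2
    · exact h
  · refine (card_component_le_of_forcing hB0 hB1 hdeg hx ha {a} (by simp) ?_).trans (by simp)
    exact fun d e hd _ _ _ => absurd ⟨d, hd⟩ hb

/-- If the dimension bound `card_component_le_add_two` is attained, every vertex of the component
has two neighbours, since a vertex with at most one neighbour would be forcing on its own. -/
lemma exists_two_adj_of_card_component_eq (hB0 : ∀ a b, a ≠ b → ¬ G.Adj a b → B a b = 0)
    (hB1 : ∀ a b, G.Adj a b → B a b ≠ 0)
    (hdeg : ∀ a b c d, G.Adj a b → G.Adj a c → G.Adj a d → b = c ∨ b = d ∨ c = d)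
    (hx : ∀ α : V → ℝ, ∑ a, α a • x a = 0 → ∀ a, ∑ b, B a b * α b = 0)
    {c : G.ConnectedComponent} (hc : (componentFinset c).card =
      finrank ℝ (Submodule.span ℝ (x '' componentFinset c)) + 2) {a : V}
    (ha : a ∈ componentFinset c) :
    ∃ b ∈ componentFinset c, ∃ d ∈ componentFinset c, b ≠ d ∧ G.Adj a b ∧ G.Adj a d := by
  classical
  by_contra hcon
  push Not at hcon
  have := card_component_le_of_forcing hB0 hB1 hdeg hx ha {a} (by simp) fun b d hb hd _ _ => by
    by_contra hbd
    exact hcon b (mem_componentFinset_of_adj ha hb) d (mem_componentFinset_of_adj ha hd) hbd hb hd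
  rw [hc] at this
  simp at this

end ComponentRank

/-! ### The conflict graph of a family of sets -/

section Family

variable {n : ℕ} {𝓕 : Finset (Finset (Fin n))} {l : ℕ}

/-- The indicator vector of a set. -/
def indVec (F : Finset (Fin n)) : Fin n → ℝ := fun i => if i ∈ F then 1 else 0

lemma indVec_eq (F : Finset (Fin n)) (i : Fin n) : indVec F i = 0 ∨ indVec F i = 1 := by
  unfold indVec
  split_ifs <;> simp

lemma indVec_injective : Function.Injective (indVec (n := n)) := fun F F' h => by
  ext i
  have := congrFun h i
  unfold indVec at this
  split_ifs at this with h1 h2 h2 <;> simp_all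

lemma indVec_dotProduct (F F' : Finset (Fin n)) :
    indVec F ⬝ᵥ indVec F' = ((F ∩ F').card : ℝ) := by
  have h : ∀ i, indVec F i * indVec F' i = if i ∈ F ∩ F' then 1 else 0 := fun i => by
    by_cases h1 : i ∈ F <;> by_cases h2 : i ∈ F' <;> simp [indVec, h1, h2]
  simp only [dotProduct, h, Finset.sum_boole, Finset.filter_univ_mem]

/-- The graph on a family of sets joining the pairs of distinct sets whose intersection does not
have size `l`. -/
def conflictGraph (𝓕 : Finset (Finset (Fin n))) (l : ℕ) : SimpleGraph 𝓕 where
  Adj F F' := F ≠ F' ∧ (F.1 ∩ F'.1).card ≠ l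
  symm := ⟨fun F F' h => ⟨h.1.symm, by rw [Finset.inter_comm]; exact h.2⟩⟩
  loopless := ⟨fun _ h => h.1 rfl⟩

/-- The excess `|F ∩ F'| - l` of an intersection size over `l`. -/
def gap (𝓕 : Finset (Finset (Fin n))) (l : ℕ) (F F' : 𝓕) : ℝ := ((F.1 ∩ F'.1).card : ℝ) - l

lemma gap_eq_zero (F F' : 𝓕) (hne : F ≠ F') (h : ¬ (conflictGraph 𝓕 l).Adj F F') :
    gap 𝓕 l F F' = 0 := by
  have : (F.1 ∩ F'.1).card = l := by
    by_contra h'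
    exact h ⟨hne, h'⟩
  simp [gap, this]

lemma gap_ne_zero (F F' : 𝓕) (h : (conflictGraph 𝓕 l).Adj F F') : gap 𝓕 l F F' ≠ 0 := fun h0 =>
  h.2 (by
    have : ((F.1 ∩ F'.1).card : ℝ) = l := by unfold gap at h0; linarith
    exact_mod_cast this)

lemma IsAlmostFisher.adj_eq (h : IsAlmostFisher 2 l 𝓕) (a b c d : 𝓕)
    (hb : (conflictGraph 𝓕 l).Adj a b) (hc : (conflictGraph 𝓕 l).Adj a c)
    (hd : (conflictGraph 𝓕 l).Adj a d) : b = c ∨ b = d ∨ c = d := by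
  by_contra hcon
  push Not at hcon
  have hsub : ({b.1, c.1, d.1} : Finset (Finset (Fin n))) ⊆
      𝓕.filter fun F' => F' ≠ a.1 ∧ (a.1 ∩ F').card ≠ l := by
    have key : ∀ e : 𝓕, (conflictGraph 𝓕 l).Adj a e →
        e.1 ∈ 𝓕.filter fun F' => F' ≠ a.1 ∧ (a.1 ∩ F').card ≠ l := fun e he =>
      Finset.mem_filter.2 ⟨e.2, fun h => he.1 (Subtype.ext h.symm), he.2⟩
    intro F hF
    simp only [Finset.mem_insert, Finset.mem_singleton] at hF
    rcases hF with rfl | rfl | rfl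
    exacts [key b hb, key c hc, key d hd]
  have h3 : ({b.1, c.1, d.1} : Finset (Finset (Fin n))).card = 3 := by
    rw [Finset.card_eq_three]
    exact ⟨b, c, d, fun h => hcon.1 (Subtype.ext h), fun h => hcon.2.1 (Subtype.ext h),
      fun h => hcon.2.2 (Subtype.ext h), rfl⟩
  have := (Finset.card_le_card hsub).trans (h a.1 a.2)
  omega

/-- The number of sets of a component is bounded exponentially in the dimension of any space
containing the differences of their indicator vectors. -/
lemma card_component_le_two_pow {c : (conflictGraph 𝓕 l).ConnectedComponent}
    (Y : Submodule ℝ (Fin n → ℝ)) {d : ℕ} (hd : finrank ℝ Y ≤ d)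
    (hY : ∀ a ∈ componentFinset c, ∀ b ∈ componentFinset c, indVec a.1 - indVec b.1 ∈ Y) :
    (componentFinset c).card ≤ 2 ^ d := by
  classical
  have hinj : Function.Injective fun a : 𝓕 => indVec a.1 :=
    indVec_injective.comp Subtype.val_injective
  rw [← Finset.card_image_of_injective (componentFinset c) hinj]
  refine card_le_two_pow_of_sub_mem d Y _ hd ?_ ?_
  · intro v hv
    obtain ⟨a, _, rfl⟩ := Finset.mem_image.1 hv
    exact indVec_eq a.1
  · intro v hv w hw
    obtain ⟨a, ha, rfl⟩ := Finset.mem_image.1 hv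
    obtain ⟨b, hb, rfl⟩ := Finset.mem_image.1 hw
    exact hY a ha b hb

/-! ### Families without a centre -/

section Nondegenerate

/-- If every kernel vector of the matrix of excesses has coordinate sum zero, then each component
has at most `3 / 2` as many sets as the dimension it spans after adding a constant coordinate. -/
lemma two_mul_card_le_of_forall_sum_eq_zero (h : IsAlmostFisher 2 l 𝓕)
    (hker : ∀ α : 𝓕 → ℝ, (∀ a, ∑ b, gap 𝓕 l a b * α b = 0) → ∑ a, α a = 0) :
    2 * 𝓕.card ≤ 3 * (n + 1) := by
  classical
  let G := conflictGraph 𝓕 l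
  let x : 𝓕 → (Fin n → ℝ) × ℝ := fun a => (indVec a.1, 1)
  have hgap : ∀ (α : 𝓕 → ℝ) a, ∑ b, gap 𝓕 l a b * α b =
      indVec a.1 ⬝ᵥ (∑ b, α b • indVec b.1) - l * ∑ b, α b := by
    intro α a
    rw [dotProduct_sum, Finset.mul_sum, ← Finset.sum_sub_distrib]
    refine Finset.sum_congr rfl fun b _ => ?_
    rw [dotProduct_smul, indVec_dotProduct, gap, smul_eq_mul]
    ring
  have hxsum : ∀ α : 𝓕 → ℝ, ∑ a, α a • x a = (∑ a, α a • indVec a.1, ∑ a, α a) := by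
    intro α
    ext
    · simp [x, Prod.fst_sum]
    · simp [x, Prod.snd_sum]
  have hx : ∀ α : 𝓕 → ℝ, ∑ a, α a • x a = 0 → ∀ a, ∑ b, gap 𝓕 l a b * α b = 0 := by
    intro α hα a
    rw [hxsum, Prod.mk_eq_zero] at hα
    rw [hgap, hα.1, hα.2]
    simp
  have hx' : ∀ α : 𝓕 → ℝ, (∀ a, ∑ b, gap 𝓕 l a b * α b = 0) → ∑ a, α a • x a = 0 := by
    intro α hα
    have h0 := hker α hα
    rw [hxsum, Prod.mk_eq_zero]
    refine ⟨?_, h0⟩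
    have h1 : ∀ a : 𝓕, indVec a.1 ⬝ᵥ (∑ b, α b • indVec b.1) = 0 := fun a => by
      have := hα a
      rw [hgap, h0] at this
      simpa using this
    rw [← dotProduct_self_eq_zero, sum_dotProduct]
    exact Finset.sum_eq_zero fun a _ => by rw [smul_dotProduct, h1, smul_zero]
  let W : G.ConnectedComponent → Submodule ℝ ((Fin n → ℝ) × ℝ) := fun c =>
    Submodule.span ℝ (x '' componentFinset c)
  have hcomp : ∀ c : G.ConnectedComponent,
      2 * (componentFinset c).card ≤ 3 * finrank ℝ (W c) := by
    intro c
    have h1 : (componentFinset c).card ≤ finrank ℝ (W c) + 2 :=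
      card_component_le_add_two gap_eq_zero gap_ne_zero h.adj_eq hx c
    -- the last coordinate cuts out a proper subspace containing all differences
    let K : Submodule ℝ ((Fin n → ℝ) × ℝ) := W c ⊓ LinearMap.ker (LinearMap.snd ℝ (Fin n → ℝ) ℝ)
    have hK : K < W c := by
      refine lt_of_le_of_ne inf_le_left fun hK => ?_
      obtain ⟨a, ha⟩ := componentFinset_nonempty c
      have : x a ∈ K := hK ▸ Submodule.subset_span ⟨a, ha, rfl⟩
      simpa [x] using this.2
    have hlt := Submodule.finrank_lt_finrank_of_lt hK
    have h2 : (componentFinset c).card ≤ 2 ^ (finrank ℝ (W c) - 1) := by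
      refine card_component_le_two_pow (K.map (LinearMap.fst ℝ (Fin n → ℝ) ℝ)) ?_ ?_
      · have := Submodule.finrank_map_le (LinearMap.fst ℝ (Fin n → ℝ) ℝ) K
        omega
      · intro a ha b hb
        refine ⟨x a - x b, ⟨(W c).sub_mem (Submodule.subset_span ⟨a, ha, rfl⟩)
          (Submodule.subset_span ⟨b, hb, rfl⟩), ?_⟩, ?_⟩
        · simp [x]
        · simp [x]
    generalize finrank ℝ (W c) = d at *
    generalize (componentFinset c).card = m at *
    rcases Nat.lt_or_ge d 4 with hd | hd
    · interval_cases d <;> simp at h2 <;> omega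
    · omega
  have hsum : ∑ c, finrank ℝ (W c) ≤ n + 1 := by
    have := sum_finrank_le_of_sum_eq_zero W ⊤ (fun _ => le_top) ?_
    · simpa using this
    intro w hw hw0 c
    have hrep : ∀ c, ∃ β : 𝓕 → ℝ, (∀ a ∉ componentFinset c, β a = 0) ∧
        ∑ a, β a • x a = w c := by
      intro c
      have := hw c
      obtain ⟨β, hβ⟩ := (Submodule.mem_span_image_finset_iff_exists_fun' ℝ).1 this
      refine ⟨fun a => if a ∈ componentFinset c then β a else 0, fun a ha => if_neg ha, ?_⟩
      rw [← hβ, ← Finset.sum_subset (Finset.subset_univ (componentFinset c))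
        fun a _ ha => by simp [ha]]
      exact Finset.sum_congr rfl fun a ha => by simp [ha]
    choose β hβ0 hβ using hrep
    have hall : ∑ a, (∑ c, β c a) • x a = 0 := by
      rw [← hw0]
      simp_rw [Finset.sum_smul]
      rw [Finset.sum_comm]
      exact Finset.sum_congr rfl fun c _ => hβ c
    -- a kernel vector restricted to a component is again a kernel vector, hence a relation
    have hg := hx _ hall
    rw [← hβ c]
    refine hx' _ fun a => ?_
    by_cases ha : a ∈ componentFinset c
    · rw [← hg a]
      refine Finset.sum_congr rfl fun b _ => ?_
      by_cases hb : b ∈ componentFinset c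
      · congr 1
        symm
        refine Finset.sum_eq_single c (fun c' _ hc' => hβ0 c' b fun hb' => hc' ?_) (by simp)
        rw [mem_componentFinset] at hb hb'
        rw [← hb, ← hb']
      · rw [hβ0 c b hb, mul_zero, gap_eq_zero a b (fun hab => hb (hab ▸ ha))
          (fun hab => hb (mem_componentFinset_of_adj ha hab)), zero_mul]
    · refine Finset.sum_eq_zero fun b _ => ?_
      by_cases hb : b ∈ componentFinset c
      · rw [gap_eq_zero a b (fun hab => ha (hab ▸ hb))
          (fun hab => ha (mem_componentFinset_of_adj hb hab.symm)), zero_mul]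
      · rw [hβ0 c b hb, mul_zero]
  have hcard : ∑ c : G.ConnectedComponent, (componentFinset c).card = 𝓕.card := by
    rw [sum_card_componentFinset, Fintype.card_coe]
  calc 2 * 𝓕.card = ∑ c : G.ConnectedComponent, 2 * (componentFinset c).card := by
        rw [← hcard, Finset.mul_sum]
    _ ≤ ∑ c, 3 * finrank ℝ (W c) := Finset.sum_le_sum fun c _ => hcomp c
    _ = 3 * ∑ c, finrank ℝ (W c) := by rw [Finset.mul_sum]
    _ ≤ 3 * (n + 1) := by omega

end Nondegenerate

end Family

/-! ### Components seen from a centre -/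

section Degenerate

variable {n : ℕ} {𝓕 : Finset (Finset (Fin n))} {l : ℕ} {z : Fin n → ℝ}

/-- The indicator vector of a member of the family, seen from `z`. -/
def relVec (z : Fin n → ℝ) (F : 𝓕) : Fin n → ℝ := indVec F.1 - z

/-- The space spanned by the vectors of a component, seen from `z`. -/
def compSpan (z : Fin n → ℝ) (c : (conflictGraph 𝓕 l).ConnectedComponent) :
    Submodule ℝ (Fin n → ℝ) :=
  Submodule.span ℝ (relVec z '' (componentFinset c : Set 𝓕))

/-- `z` is a centre of the family: it has inner product `l` with itself and with every member, so
that the excess of `|F ∩ F'|` over `l` is the inner product of `F` and `F'` as seen from `z`. -/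
structure IsCentre (𝓕 : Finset (Finset (Fin n))) (l : ℕ) (z : Fin n → ℝ) : Prop where
  dotProduct_self : z ⬝ᵥ z = l
  dotProduct_indVec : ∀ F ∈ 𝓕, z ⬝ᵥ indVec F = l

lemma relVec_isCubeVertexFrom (a : 𝓕) : IsCubeVertexFrom z (relVec z a) := fun i => by
  rcases indVec_eq a.1 i with h | h <;> simp [relVec, h]

lemma relVec_injective : Function.Injective (relVec z : 𝓕 → Fin n → ℝ) := fun _ _ h =>
  Subtype.ext (indVec_injective (sub_left_injective h))

lemma relVec_eq_neg_iff (a : 𝓕) (i : Fin n) : relVec z a i = - z i ↔ i ∉ a.1 := by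
  by_cases h : i ∈ a.1 <;> simp [relVec, indVec, h]

lemma relVec_mem_compSpan {c : (conflictGraph 𝓕 l).ConnectedComponent} {a : 𝓕}
    (ha : a ∈ componentFinset c) : relVec z a ∈ compSpan z c :=
  Submodule.subset_span ⟨a, ha, rfl⟩

namespace IsCentre

variable (hz : IsCentre 𝓕 l z)
include hz

lemma dotProduct_relVec (a : 𝓕) : z ⬝ᵥ relVec z a = 0 := by
  rw [relVec, dotProduct_sub, hz.dotProduct_indVec _ a.2, hz.dotProduct_self, sub_self]

lemma relVec_dotProduct (a b : 𝓕) : relVec z a ⬝ᵥ relVec z b = gap 𝓕 l a b := by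
  rw [relVec, sub_dotProduct, hz.dotProduct_relVec, sub_zero, relVec, dotProduct_sub,
    indVec_dotProduct, dotProduct_comm, hz.dotProduct_indVec _ a.2, gap]

lemma sum_gap_eq_zero (α : 𝓕 → ℝ) (hα : ∑ a, α a • relVec z a = 0) (a : 𝓕) :
    ∑ b, gap 𝓕 l a b * α b = 0 := by
  have := congrArg (fun u => relVec z a ⬝ᵥ u) hα
  simp only [dotProduct_sum, dotProduct_smul, smul_eq_mul, dotProduct_zero,
    hz.relVec_dotProduct] at this
  rw [← this]
  exact Finset.sum_congr rfl fun b _ => mul_comm _ _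

lemma compSpan_le_ker (c : (conflictGraph 𝓕 l).ConnectedComponent) {u : Fin n → ℝ}
    (hu : u ∈ compSpan z c) : z ⬝ᵥ u = 0 := by
  induction hu using Submodule.span_induction with
  | mem u hu =>
    obtain ⟨a, _, rfl⟩ := hu
    exact hz.dotProduct_relVec a
  | zero => exact dotProduct_zero _
  | add u v _ _ hu hv => rw [dotProduct_add, hu, hv, add_zero]
  | smul t u _ hu => rw [dotProduct_smul, hu, smul_zero]

lemma dotProduct_eq_zero_of_ne {c c' : (conflictGraph 𝓕 l).ConnectedComponent} (hcc : c ≠ c')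
    {u w : Fin n → ℝ} (hu : u ∈ compSpan z c) (hw : w ∈ compSpan z c') : u ⬝ᵥ w = 0 := by
  induction hu using Submodule.span_induction with
  | mem u hu =>
    obtain ⟨a, ha, rfl⟩ := hu
    induction hw using Submodule.span_induction with
    | mem w hw =>
      obtain ⟨b, hb, rfl⟩ := hw
      rw [hz.relVec_dotProduct]
      have hne : b ∉ componentFinset c := fun hb' => hcc <| by
        rw [SetLike.mem_coe, mem_componentFinset] at hb
        rw [mem_componentFinset] at hb'
        rw [← hb, ← hb']
      exact gap_eq_zero a b (fun h => hne (h ▸ ha))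
        fun h => hne (mem_componentFinset_of_adj ha h)
    | zero => exact dotProduct_zero _
    | add u v _ _ hu hv => rw [dotProduct_add, hu, hv, add_zero]
    | smul t u _ hu => rw [dotProduct_smul, hu, smul_zero]
  | zero => exact zero_dotProduct _
  | add u v _ _ hu hv => rw [add_dotProduct, hu, hv, add_zero]
  | smul t u _ hu => rw [smul_dotProduct, hu, smul_zero]

lemma sum_finrank_le [Fintype (conflictGraph 𝓕 l).ConnectedComponent]
    (U : (conflictGraph 𝓕 l).ConnectedComponent → Submodule ℝ (Fin n → ℝ))
    (hU : ∀ c, U c ≤ compSpan z c) (Z : Submodule ℝ (Fin n → ℝ)) (hUZ : ∀ c, U c ≤ Z) :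
    ∑ c, finrank ℝ (U c) ≤ finrank ℝ Z := by
  refine sum_finrank_le_of_sum_eq_zero U Z hUZ fun w hw hsum c => ?_
  rw [← dotProduct_self_eq_zero]
  have := congrArg (fun u => w c ⬝ᵥ u) hsum
  simp only [dotProduct_sum, dotProduct_zero] at this
  rwa [Finset.sum_eq_single c (fun c' _ hc' => hz.dotProduct_eq_zero_of_ne hc'.symm
    (hU c (hw c)) (hU c' (hw c'))) (by simp)] at this

omit hz in
lemma card_component_le_two_pow_finrank (c : (conflictGraph 𝓕 l).ConnectedComponent) :
    (componentFinset c).card ≤ 2 ^ finrank ℝ (compSpan z c) :=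
  card_component_le_two_pow (compSpan z c) le_rfl fun a ha b hb => by
    simpa [relVec] using (compSpan z c).sub_mem (relVec_mem_compSpan (z := z) ha)
      (relVec_mem_compSpan (z := z) hb)

omit hz in
/-- If a coordinate of `z` is nonzero although no set of the component contains it, then the
differences inside the component do not span, so that the component is small. -/
lemma card_component_le_of_forall_notMem {c : (conflictGraph 𝓕 l).ConnectedComponent} {i : Fin n}
    (hi : z i ≠ 0) (hc : ∀ a ∈ componentFinset c, i ∉ a.1) :
    0 < finrank ℝ (compSpan z c) ∧
      (componentFinset c).card ≤ 2 ^ (finrank ℝ (compSpan z c) - 1) := by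
  let K : Submodule ℝ (Fin n → ℝ) := compSpan z c ⊓ LinearMap.ker (LinearMap.proj i)
  have hK : K < compSpan z c := by
    refine lt_of_le_of_ne inf_le_left fun hK => ?_
    obtain ⟨a, ha⟩ := componentFinset_nonempty c
    have h1 : relVec z a ∈ K := hK ▸ relVec_mem_compSpan ha
    have h2 : relVec z a i = 0 := h1.2
    rw [(relVec_eq_neg_iff a i).2 (hc a ha)] at h2
    exact hi (neg_eq_zero.1 h2)
  have hlt := Submodule.finrank_lt_finrank_of_lt hK
  refine ⟨by omega, card_component_le_two_pow K (by omega) fun a ha b hb => ⟨?_, ?_⟩⟩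
  · simpa [relVec] using (compSpan z c).sub_mem (relVec_mem_compSpan (z := z) ha)
      (relVec_mem_compSpan (z := z) hb)
  · simp [indVec, hc a ha, hc b hb]

lemma card_component_le_finrank_add_two (h : IsAlmostFisher 2 l 𝓕)
    (c : (conflictGraph 𝓕 l).ConnectedComponent) :
    (componentFinset c).card ≤ finrank ℝ (compSpan z c) + 2 :=
  card_component_le_add_two gap_eq_zero gap_ne_zero h.adj_eq hz.sum_gap_eq_zero c

lemma exists_two_adj (h : IsAlmostFisher 2 l 𝓕) {c : (conflictGraph 𝓕 l).ConnectedComponent}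
    (hc : (componentFinset c).card = finrank ℝ (compSpan z c) + 2) :
    ∀ a ∈ componentFinset c, ∃ b ∈ componentFinset c, ∃ d ∈ componentFinset c, b ≠ d ∧
      (conflictGraph 𝓕 l).Adj a b ∧ (conflictGraph 𝓕 l).Adj a d := fun _ ha =>
  exists_two_adj_of_card_component_eq gap_eq_zero gap_ne_zero h.adj_eq hz.sum_gap_eq_zero hc ha

lemma dotProduct_relVec_ne_zero {a b : 𝓕} (h : (conflictGraph 𝓕 l).Adj a b) :
    relVec z a ⬝ᵥ relVec z b ≠ 0 := by
  rw [hz.relVec_dotProduct]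
  exact gap_ne_zero a b h

lemma dotProduct_relVec_eq_zero {a b : 𝓕} (hne : a ≠ b) (h : ¬ (conflictGraph 𝓕 l).Adj a b) :
    relVec z a ⬝ᵥ relVec z b = 0 := by
  rw [hz.relVec_dotProduct]
  exact gap_eq_zero a b hne h

/-- A component that attains the bound `2 ^ d` in a dimension `d` of at most two: its span lies
in the fractional coordinates and contains `halfDefect z`, and three of its sets, not necessarily
distinct, cover the others. -/
lemma full_component (h : IsAlmostFisher 2 l 𝓕) {c : (conflictGraph 𝓕 l).ConnectedComponent}
    (hd : finrank ℝ (compSpan z c) ≤ 2)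
    (hc : (componentFinset c).card = 2 ^ finrank ℝ (compSpan z c)) :
    compSpan z c ≤ fracSupported z ∧ halfDefect z ∈ compSpan z c ∧
      ∃ a ∈ componentFinset c, ∃ b ∈ componentFinset c, ∃ d ∈ componentFinset c,
        ∀ i, i ∉ a.1 → i ∉ b.1 → i ∉ d.1 → ∀ e ∈ componentFinset c, i ∉ e.1 := by
  have hspan : (∀ a ∈ componentFinset c, relVec z a ∈ fracSupported z) →
      compSpan z c ≤ fracSupported z := fun h' => Submodule.span_le.2 (by
    rintro _ ⟨a, ha, rfl⟩
    exact h' a ha)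
  obtain hd0 | hd1 | hd2 : finrank ℝ (compSpan z c) = 0 ∨ finrank ℝ (compSpan z c) = 1 ∨
      finrank ℝ (compSpan z c) = 2 := by omega
  · rw [hd0, pow_zero, Finset.card_eq_one] at hc
    obtain ⟨a, ha⟩ := hc
    have hbot : compSpan z c = ⊥ := Submodule.finrank_eq_zero.1 hd0
    have haz : relVec z a = 0 := by
      have : relVec z a ∈ compSpan z c := relVec_mem_compSpan (by simp [ha])
      simpa [hbot] using this
    have hzi : ∀ i, z i = 0 ∨ z i = 1 := fun i => by
      have : indVec a.1 i - z i = 0 := congrFun haz i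
      rcases indVec_eq a.1 i with h' | h' <;> rw [h'] at this
      · left; linarith
      · right; linarith
    refine ⟨hbot ▸ bot_le, ?_, a, by simp [ha], a, by simp [ha], a, by simp [ha], ?_⟩
    · have : halfDefect z = 0 := funext fun i => if_pos (hzi i)
      rw [this]
      exact Submodule.zero_mem _
    · intro i hi _ _ e he
      rw [ha, Finset.mem_singleton] at he
      exact he ▸ hi
  · rw [hd1, pow_one, Finset.card_eq_two] at hc
    obtain ⟨a, b, hab, hc⟩ := hc
    have ha : a ∈ componentFinset c := by simp [hc]
    have hb : b ∈ componentFinset c := by simp [hc]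
    have hadj : (conflictGraph 𝓕 l).Adj a b := by
      have hr : (conflictGraph 𝓕 l).Reachable a b := by
        rw [mem_componentFinset] at ha hb
        exact SimpleGraph.ConnectedComponent.exact (ha.trans hb.symm)
      obtain ⟨p⟩ := hr
      cases p with
      | nil => exact absurd rfl hab
      | @cons _ d _ had p =>
        have hd : d ∈ componentFinset c := mem_componentFinset_of_adj ha had
        rw [hc, Finset.mem_insert, Finset.mem_singleton] at hd
        rcases hd with rfl | rfl
        · exact absurd had (conflictGraph 𝓕 l).irrefl
        · exact had
    obtain ⟨h1, h2, h3⟩ := fracSupported_of_pair (compSpan z c) hd1.le (relVec_mem_compSpan ha)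
      (relVec_mem_compSpan hb) (relVec_isCubeVertexFrom a) (relVec_isCubeVertexFrom b)
      (relVec_injective.ne hab) (hz.dotProduct_relVec_ne_zero hadj)
    refine ⟨hspan fun e he => ?_, h3, a, ha, b, hb, b, hb, fun i hia hib _ e he => ?_⟩ <;>
    · rw [hc, Finset.mem_insert, Finset.mem_singleton] at he
      rcases he with rfl | rfl <;> assumption
  · rw [hd2] at hc
    obtain ⟨a, b, d, e, hs, hnd, hab, hbd, hde, hea, nad, nbe⟩ := exists_quad h.adj_eq hc
      (hz.exists_two_adj h (by rw [hc, hd2]; rfl))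
    simp only [List.nodup_cons, List.mem_cons, List.not_mem_nil, or_false, not_or] at hnd
    have ha : a ∈ componentFinset c := by simp [hs]
    have hb : b ∈ componentFinset c := by simp [hs]
    have hd : d ∈ componentFinset c := by simp [hs]
    have he : e ∈ componentFinset c := by simp [hs]
    obtain ⟨⟨⟨f1, f2, f3, f4⟩, hh⟩, hcov⟩ := quad_structure (compSpan z c) hd2.le
      (relVec_mem_compSpan ha) (relVec_mem_compSpan hb) (relVec_mem_compSpan hd)
      (relVec_mem_compSpan he) (relVec_isCubeVertexFrom a) (relVec_isCubeVertexFrom b)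
      (relVec_isCubeVertexFrom d) (relVec_isCubeVertexFrom e) (hz.dotProduct_relVec a)
      (hz.dotProduct_relVec b) (hz.dotProduct_relVec d) (hz.dotProduct_relVec e)
      (relVec_injective.ne hnd.1.1) (relVec_injective.ne hnd.1.2.1)
      (relVec_injective.ne hnd.1.2.2) (relVec_injective.ne hnd.2.1.1)
      (relVec_injective.ne hnd.2.1.2) (relVec_injective.ne hnd.2.2.1)
      (hz.dotProduct_relVec_eq_zero hnd.1.2.1 nad) (hz.dotProduct_relVec_eq_zero hnd.2.1.2 nbe)
      (hz.dotProduct_relVec_ne_zero hab) (hz.dotProduct_relVec_ne_zero hbd.symm)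
      (hz.dotProduct_relVec_ne_zero hea.symm) (hz.dotProduct_relVec_ne_zero hde)
    refine ⟨hspan fun x hx => ?_, hh, ?_⟩
    · rcases (hs x).1 hx with rfl | rfl | rfl | rfl <;> assumption
    · simp only [relVec_eq_neg_iff] at hcov
      rcases hcov with hcov | hcov
      · refine ⟨a, ha, b, hb, b, hb, fun i hia hib _ x hx => ?_⟩
        have := hcov i hia hib
        rcases (hs x).1 hx with rfl | rfl | rfl | rfl
        exacts [hia, hib, this.1, this.2]
      · refine ⟨a, ha, e, he, e, he, fun i hia hib _ x hx => ?_⟩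
        have := hcov i hia hib
        rcases (hs x).1 hx with rfl | rfl | rfl | rfl
        exacts [hia, this.1, this.2, hib]

/-- A component with five sets spanning dimension three: its span meets the fractional coordinates,
and three of its sets cover the others. -/
lemma pentagon_component (h : IsAlmostFisher 2 l 𝓕)
    {c : (conflictGraph 𝓕 l).ConnectedComponent} (hd : finrank ℝ (compSpan z c) = 3)
    (hc : (componentFinset c).card = 5) :
    0 < finrank ℝ (compSpan z c ⊓ fracSupported z : Submodule ℝ (Fin n → ℝ)) ∧
      ∃ a ∈ componentFinset c, ∃ b ∈ componentFinset c, ∃ d ∈ componentFinset c,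
        ∀ i, i ∉ a.1 → i ∉ b.1 → i ∉ d.1 → ∀ e ∈ componentFinset c, i ∉ e.1 := by
  obtain ⟨g, hg, hs, hadj, hnadj⟩ := exists_pentagon h.adj_eq hc
    (hz.exists_two_adj h (by rw [hc, hd]))
  have hgs : ∀ j, g j ∈ componentFinset c := fun j => (hs _).2 ⟨j, rfl⟩
  obtain ⟨⟨u, hu, hu0, huf⟩, a, b, d, hcov⟩ := pentagon_structure (compSpan z c) hd.le
    (fun j => relVec z (g j)) (fun j => relVec_mem_compSpan (hgs j))
    (fun j => relVec_isCubeVertexFrom _) (fun j => hz.dotProduct_relVec _)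
    (relVec_injective.comp hg)
    (fun j => hz.dotProduct_relVec_eq_zero (hg.ne (by revert j; decide)) (hnadj j))
    (fun j => hz.dotProduct_relVec_ne_zero (hadj j))
  refine ⟨?_, g a, hgs a, g b, hgs b, g d, hgs d, fun i ha hb hd' e he => ?_⟩
  · rw [Module.finrank_pos_iff_exists_ne_zero]
    exact ⟨⟨u, hu, huf⟩, fun h' => hu0 (congrArg Subtype.val h')⟩
  · obtain ⟨j, rfl⟩ := (hs e).1 he
    simp only [relVec_eq_neg_iff] at hcov
    exact hcov i ha hb hd' j

end IsCentre

end Degenerate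

/-! ### The fractional coordinates of a centre -/

section FracSet

variable {n : ℕ}

open Classical in
/-- The coordinates where `z` is fractional. -/
noncomputable def fracSet (z : Fin n → ℝ) : Finset (Fin n) :=
  Finset.univ.filter fun i => ¬ (z i = 0 ∨ z i = 1)

lemma mem_fracSet {z : Fin n → ℝ} {i : Fin n} : i ∈ fracSet z ↔ ¬ (z i = 0 ∨ z i = 1) := by
  simp [fracSet]

lemma finrank_fracSupported_le (z : Fin n → ℝ) :
    finrank ℝ (fracSupported z) ≤ (fracSet z).card := by
  let Φ : fracSupported z →ₗ[ℝ] (fracSet z → ℝ) :=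
    LinearMap.pi fun i => (LinearMap.proj (i : Fin n)).comp (fracSupported z).subtype
  have hinj : Function.Injective Φ := by
    rw [← LinearMap.ker_eq_bot, LinearMap.ker_eq_bot']
    intro u hu
    refine Subtype.ext (funext fun i => ?_)
    by_cases hi : z i = 0 ∨ z i = 1
    · exact u.2 i hi
    · exact congrFun hu ⟨i, mem_fracSet.2 hi⟩
  have := LinearMap.finrank_le_finrank_of_injective hinj
  simpa using this

/-- If `z` takes only the values `0`, `1 / 2` and `1`, its squared norm controls the number of
coordinates equal to `1 / 2`. -/
lemma card_fracSet_le_of_halfDefect_eq_zero {z : Fin n → ℝ} {l : ℕ} (hzz : z ⬝ᵥ z = l)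
    (h : halfDefect z = 0) :
    (fracSet z).card ≤ 4 * l ∧ 3 * (fracSet z).card + 4 * l ≤ 4 * n := by
  classical
  let O : Finset (Fin n) := Finset.univ.filter fun i => z i = 1
  have hdisj : Disjoint (fracSet z) O := by
    rw [Finset.disjoint_left]
    intro i hi hO
    exact mem_fracSet.1 hi (Or.inr (Finset.mem_filter.1 hO).2)
  have hterm : ∀ i, 4 * (z i * z i) =
      (if i ∈ fracSet z then 1 else 0) + 4 * (if i ∈ O then 1 else 0) := by
    intro i
    have hi := congrFun h i
    by_cases h0 : z i = 0
    · simp [mem_fracSet, O, h0]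
    by_cases h1 : z i = 1
    · simp [mem_fracSet, O, h1]
    · simp only [halfDefect, h0, h1, or_self, if_false, Pi.zero_apply] at hi
      have h2 : z i = 1 / 2 := by linarith
      simp [mem_fracSet, O, h2]
      norm_num
  have hsum : (4 * l : ℝ) = (fracSet z).card + 4 * O.card := by
    rw [← hzz, dotProduct, Finset.mul_sum, Finset.sum_congr rfl fun i _ => hterm i,
      Finset.sum_add_distrib, ← Finset.mul_sum]
    simp
  have hsum' : 4 * l = (fracSet z).card + 4 * O.card := by exact_mod_cast hsum
  have hle : (fracSet z).card + O.card ≤ n := by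
    rw [← Finset.card_union_of_disjoint hdisj]
    simpa using Finset.card_le_univ (fracSet z ∪ O)
  omega

end FracSet

/-! ### Summation over the components -/

lemma sum_ite_le_one {κ : Type*} [Fintype κ] (P : κ → Prop) [DecidablePred P]
    (h : ∀ c c', P c → P c' → c = c') : ∑ c, (if P c then 1 else 0) ≤ 1 := by
  rw [← Finset.card_filter]
  exact Finset.card_le_one.2 fun c hc c' hc' =>
    h c c' (Finset.mem_filter.1 hc).2 (Finset.mem_filter.1 hc').2

section Degenerate

variable {n : ℕ} {𝓕 : Finset (Finset (Fin n))} {l : ℕ} {z : Fin n → ℝ}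

namespace IsCentre

variable (hz : IsCentre 𝓕 l z) (h : IsAlmostFisher 2 l 𝓕)
include hz h

/-- Components are of ratio at most `3 / 2`, or of one of the four exceptional types. -/
lemma card_finrank_cases (c : (conflictGraph 𝓕 l).ConnectedComponent) :
    2 * (componentFinset c).card ≤ 3 * finrank ℝ (compSpan z c) ∨
    (finrank ℝ (compSpan z c) ≤ 2 ∧
      (componentFinset c).card = 2 ^ finrank ℝ (compSpan z c)) ∨
    (finrank ℝ (compSpan z c) = 3 ∧ (componentFinset c).card = 5) := by
  have h1 := hz.card_component_le_finrank_add_two h c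
  have h2 := card_component_le_two_pow_finrank (z := z) c
  generalize finrank ℝ (compSpan z c) = d at *
  generalize (componentFinset c).card = m at *
  rcases Nat.lt_or_ge d 4 with hd | hd
  · interval_cases d <;> simp at h2 ⊢ <;> omega
  · omega

/-- In an exceptional component three sets cover the fractional coordinates: they cover what the
component covers, and by `card_component_le_of_forall_notMem` the component is too large to avoid a
coordinate where `z` is nonzero. -/
lemma cover_of_exceptional {c : (conflictGraph 𝓕 l).ConnectedComponent}
    (hc : 3 * finrank ℝ (compSpan z c) < 2 * (componentFinset c).card) :
    ∃ a ∈ componentFinset c, ∃ b ∈ componentFinset c, ∃ d ∈ componentFinset c,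
      ∀ i ∈ fracSet z, i ∈ a.1 ∨ i ∈ b.1 ∨ i ∈ d.1 := by
  have key : ∃ a ∈ componentFinset c, ∃ b ∈ componentFinset c, ∃ d ∈ componentFinset c,
      ∀ i, i ∉ a.1 → i ∉ b.1 → i ∉ d.1 → ∀ e ∈ componentFinset c, i ∉ e.1 := by
    rcases hz.card_finrank_cases h c with h1 | h1 | h1
    · omega
    · exact (hz.full_component h h1.1 h1.2).2.2
    · exact (hz.pentagon_component h h1.1 h1.2).2
  obtain ⟨a, ha, b, hb, d, hd, hcov⟩ := key
  refine ⟨a, ha, b, hb, d, hd, fun i hi => ?_⟩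
  by_contra hcon
  push Not at hcon
  have hi0 : z i ≠ 0 := fun h0 => mem_fracSet.1 hi (Or.inl h0)
  have h2 := card_component_le_of_forall_notMem hi0 (hcov i hcon.1 hcon.2.1 hcon.2.2)
  rcases hz.card_finrank_cases h c with h1 | h1 | h1
  · omega
  · have : 2 ^ (finrank ℝ (compSpan z c) - 1) < 2 ^ finrank ℝ (compSpan z c) :=
      Nat.pow_lt_pow_right (by norm_num) (by omega)
    omega
  · rw [h1.1, h1.2] at h2
    norm_num at h2

/-- Two exceptional components confine the fractional coordinates to few intersections of sets. -/
lemma card_fracSet_le_of_two_exceptional {c c' : (conflictGraph 𝓕 l).ConnectedComponent}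
    (hcc : c ≠ c') (hc : 3 * finrank ℝ (compSpan z c) < 2 * (componentFinset c).card)
    (hc' : 3 * finrank ℝ (compSpan z c') < 2 * (componentFinset c').card) :
    (fracSet z).card ≤ 9 * l := by
  classical
  obtain ⟨a, ha, b, hb, d, hd, hcov⟩ := hz.cover_of_exceptional h hc
  obtain ⟨a', ha', b', hb', d', hd', hcov'⟩ := hz.cover_of_exceptional h hc'
  have hinter : ∀ u ∈ componentFinset c, ∀ u' ∈ componentFinset c', (u.1 ∩ u'.1).card = l := by
    intro u hu u' hu'
    have hne : u' ∉ componentFinset c := fun hu'' => hcc <| by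
      rw [mem_componentFinset] at hu' hu''
      rw [← hu', ← hu'']
    by_contra hcard
    exact hne (mem_componentFinset_of_adj hu ⟨fun h' => hne (h' ▸ hu), hcard⟩)
  let S : Finset 𝓕 := {a, b, d}
  let S' : Finset 𝓕 := {a', b', d'}
  have hsub : fracSet z ⊆ (S ×ˢ S').biUnion fun p => p.1.1 ∩ p.2.1 := by
    intro i hi
    have h1 : ∃ u ∈ S, i ∈ u.1 := by
      rcases hcov i hi with h' | h' | h'
      exacts [⟨a, by simp [S], h'⟩, ⟨b, by simp [S], h'⟩, ⟨d, by simp [S], h'⟩]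
    have h2 : ∃ u ∈ S', i ∈ u.1 := by
      rcases hcov' i hi with h' | h' | h'
      exacts [⟨a', by simp [S'], h'⟩, ⟨b', by simp [S'], h'⟩, ⟨d', by simp [S'], h'⟩]
    obtain ⟨u, hu, hiu⟩ := h1
    obtain ⟨u', hu', hiu'⟩ := h2
    exact Finset.mem_biUnion.2 ⟨(u, u'), Finset.mk_mem_product hu hu',
      Finset.mem_inter.2 ⟨hiu, hiu'⟩⟩
  have hle := (Finset.card_le_card hsub).trans
    (Finset.card_biUnion_le_card_mul (S ×ˢ S') _ l fun p hp => le_of_eq ?_)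
  · have h9 : (S ×ˢ S').card ≤ 9 := by
      rw [Finset.card_product]
      exact Nat.mul_le_mul Finset.card_le_three Finset.card_le_three
    exact hle.trans (Nat.mul_le_mul_right l h9)
  · obtain ⟨hp1, hp2⟩ := Finset.mem_product.1 hp
    simp only [S, S', Finset.mem_insert, Finset.mem_singleton] at hp1 hp2
    refine hinter _ ?_ _ ?_
    · rcases hp1 with hp | hp | hp <;> rw [hp] <;> assumption
    · rcases hp2 with hp | hp | hp <;> rw [hp] <;> assumption

/-- The number of sets of a component, up to the dimensions it spans in total and within the
fractional coordinates. -/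
lemma card_component_bounds (c : (conflictGraph 𝓕 l).ConnectedComponent) :
    2 * (componentFinset c).card ≤ 3 * finrank ℝ (compSpan z c) +
      finrank ℝ (compSpan z c ⊓ fracSupported z : Submodule ℝ (Fin n → ℝ)) +
      2 * (if finrank ℝ (compSpan z c) = 0 then 1 else 0) ∧
    3 * (componentFinset c).card ≤ 5 * finrank ℝ (compSpan z c) +
      finrank ℝ (compSpan z c ⊓ fracSupported z : Submodule ℝ (Fin n → ℝ)) +
      3 * (if finrank ℝ (compSpan z c) = 0 then 1 else 0) ∧
    (componentFinset c).card ≤ 2 * finrank ℝ (compSpan z c) +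
      (if finrank ℝ (compSpan z c) = 0 then 1 else 0) := by
  rcases hz.card_finrank_cases h c with h1 | h1 | h1
  · split_ifs <;> omega
  · rw [inf_eq_left.2 (hz.full_component h h1.1 h1.2).1]
    obtain ⟨h1, h2⟩ := h1
    generalize finrank ℝ (compSpan z c) = d at *
    rw [h2]
    interval_cases d <;> norm_num
  · have := (hz.pentagon_component h h1.1 h1.2).1
    rw [h1.1, h1.2]
    norm_num
    omega

omit hz h in
lemma eq_of_finrank_eq_zero (c c' : (conflictGraph 𝓕 l).ConnectedComponent)
    (hc : finrank ℝ (compSpan z c) = 0) (hc' : finrank ℝ (compSpan z c') = 0) : c = c' := by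
  have key : ∀ c : (conflictGraph 𝓕 l).ConnectedComponent, finrank ℝ (compSpan z c) = 0 →
      ∃ a ∈ componentFinset c, relVec z a = 0 := fun c hc => by
    obtain ⟨a, ha⟩ := componentFinset_nonempty c
    have := relVec_mem_compSpan (z := z) ha
    rw [Submodule.finrank_eq_zero.1 hc, Submodule.mem_bot] at this
    exact ⟨a, ha, this⟩
  obtain ⟨a, ha, ha0⟩ := key c hc
  obtain ⟨b, hb, hb0⟩ := key c' hc'
  have := relVec_injective (ha0.trans hb0.symm)
  rw [mem_componentFinset] at ha hb
  rw [← ha, ← hb, this]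

omit hz h in
lemma fracSet_eq_empty_of_finrank_eq_zero {c : (conflictGraph 𝓕 l).ConnectedComponent}
    (hc : finrank ℝ (compSpan z c) = 0) : fracSet z = ∅ := by
  obtain ⟨a, ha⟩ := componentFinset_nonempty c
  have h0 := relVec_mem_compSpan (z := z) ha
  rw [Submodule.finrank_eq_zero.1 hc, Submodule.mem_bot] at h0
  refine Finset.eq_empty_of_forall_notMem fun i hi => mem_fracSet.1 hi ?_
  have : indVec a.1 i - z i = 0 := congrFun h0 i
  rcases indVec_eq a.1 i with h' | h' <;> rw [h'] at this
  · left; linarith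
  · right; linarith

/-- The three bounds for a family with a centre, in terms of the dimension `D` spanned by the
family as seen from the centre. -/
lemma card_bounds : ∃ D : ℕ, D ≤ n ∧ (0 < l → D + 1 ≤ n) ∧
    (𝓕.card ≤ 2 * D ∨ 2 * 𝓕.card ≤ 3 * D + 2) ∧
    2 * 𝓕.card ≤ 3 * D + 9 * l + 2 ∧
    (3 * 𝓕.card ≤ 5 * D + 3 ∨
      ∃ f, 3 * 𝓕.card ≤ 5 * D + f + 3 ∧ f ≤ 4 * l ∧ 3 * f + 4 * l ≤ 4 * n) := by
  classical
  let K := (conflictGraph 𝓕 l).ConnectedComponent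
  let m : K → ℕ := fun c => (componentFinset c).card
  let d : K → ℕ := fun c => finrank ℝ (compSpan z c)
  let r : K → ℕ := fun c =>
    finrank ℝ (compSpan z c ⊓ fracSupported z : Submodule ℝ (Fin n → ℝ))
  let t : K → ℕ := fun c => if finrank ℝ (compSpan z c) = 0 then 1 else 0
  have hm : ∑ c, m c = 𝓕.card := by
    rw [← Fintype.card_coe]
    exact sum_card_componentFinset
  have hr : ∑ c, r c ≤ (fracSet z).card :=
    (hz.sum_finrank_le (fun c => compSpan z c ⊓ fracSupported z) (fun c => inf_le_left)
      (fracSupported z) fun c => inf_le_right).trans (finrank_fracSupported_le z)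
  have ht : ∑ c, t c ≤ 1 := sum_ite_le_one _ fun c c' hc hc' =>
    eq_of_finrank_eq_zero c c' hc hc'
  have hb : ∀ c, 2 * m c ≤ 3 * d c + r c + 2 * t c ∧ 3 * m c ≤ 5 * d c + r c + 3 * t c ∧
      m c ≤ 2 * d c + t c := hz.card_component_bounds h
  have hb1 : 2 * ∑ c, m c ≤ 3 * ∑ c, d c + ∑ c, r c + 2 * ∑ c, t c := by
    simp only [Finset.mul_sum, ← Finset.sum_add_distrib]
    exact Finset.sum_le_sum fun c _ => (hb c).1
  have hb2 : 3 * ∑ c, m c ≤ 5 * ∑ c, d c + ∑ c, r c + 3 * ∑ c, t c := by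
    simp only [Finset.mul_sum, ← Finset.sum_add_distrib]
    exact Finset.sum_le_sum fun c _ => (hb c).2.1
  have hb3 : ∑ c, m c ≤ 2 * ∑ c, d c + ∑ c, t c := by
    simp only [Finset.mul_sum, ← Finset.sum_add_distrib]
    exact Finset.sum_le_sum fun c _ => (hb c).2.2
  have hrd : ∀ c, r c ≤ d c := fun c => Submodule.finrank_mono inf_le_left
  refine ⟨∑ c, d c, ?_, fun hl => ?_, ?_, ?_, ?_⟩
  · simpa using hz.sum_finrank_le (fun c => compSpan z c) (fun c => le_rfl) ⊤ fun c => le_top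
  · -- all the vectors are orthogonal to the nonzero vector `z`
    let Z : Submodule ℝ (Fin n → ℝ) :=
      { carrier := {u | z ⬝ᵥ u = 0}
        add_mem' := fun {u v} hu hv => by
          rw [Set.mem_ofPred_eq] at hu hv ⊢
          rw [dotProduct_add, hu, hv, add_zero]
        zero_mem' := dotProduct_zero z
        smul_mem' := fun s u hu => by
          rw [Set.mem_ofPred_eq] at hu ⊢
          rw [dotProduct_smul, hu, smul_zero] }
    have hZ : Z < ⊤ := by
      refine lt_top_iff_ne_top.2 fun htop => ?_
      have hzZ : z ∈ Z := htop ▸ Submodule.mem_top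
      have h0 : z ⬝ᵥ z = 0 := hzZ
      rw [hz.dotProduct_self] at h0
      exact hl.ne' (by exact_mod_cast h0)
    have h1 := hz.sum_finrank_le (fun c => compSpan z c) (fun c => le_rfl) Z
      fun c u hu => hz.compSpan_le_ker c hu
    have h2 := Submodule.finrank_lt_finrank_of_lt hZ
    simp only [finrank_top, finrank_fintype_fun_eq_card, Fintype.card_fin] at h2
    exact lt_of_le_of_lt h1 h2
  · by_cases hiso : ∃ c : K, finrank ℝ (compSpan z c) = 0
    · -- `z` is Boolean, so that no dimension is left for the other exceptional types
      obtain ⟨c, hc⟩ := hiso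
      rw [fracSet_eq_empty_of_finrank_eq_zero hc, Finset.card_empty] at hr
      right
      omega
    · left
      have : ∑ c, t c = 0 := Finset.sum_eq_zero fun c _ => if_neg fun hc => hiso ⟨c, hc⟩
      omega
  · by_cases htwo : ∃ c c' : K, c ≠ c' ∧ 3 * d c < 2 * m c ∧ 3 * d c' < 2 * m c'
    · obtain ⟨c, c', hcc, hc, hc'⟩ := htwo
      have := hz.card_fracSet_le_of_two_exceptional h hcc hc hc'
      omega
    · have hone := sum_ite_le_one (fun c => 3 * d c < 2 * m c) fun c c' hc hc' => by
        by_contra hcc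
        exact htwo ⟨c, c', hcc, hc, hc'⟩
      have : 2 * ∑ c, m c ≤ 3 * ∑ c, d c + 2 * ∑ c, (if 3 * d c < 2 * m c then 1 else 0) := by
        simp only [Finset.mul_sum, ← Finset.sum_add_distrib]
        refine Finset.sum_le_sum fun c _ => ?_
        split_ifs with hc
        · rcases hz.card_finrank_cases h c with h1 | ⟨h1, h2⟩ | h1
          · change 2 * m c ≤ 3 * d c at h1
            omega
          · change m c = 2 ^ d c at h2
            change d c ≤ 2 at h1
            rw [h2]
            generalize d c = e at *
            interval_cases e <;> norm_num
          · have e1 : d c = 3 := h1.1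
            have e2 : m c = 5 := h1.2
            omega
        · omega
      omega
  · by_cases htwo : ∃ c c' : K, c ≠ c' ∧ 5 * d c < 3 * m c ∧ 5 * d c' < 3 * m c'
    · obtain ⟨c, c', hcc, hc, hc'⟩ := htwo
      -- the defect of `z` from `1 / 2` lies in two orthogonal spaces
      have hmem : ∀ c : K, 5 * d c < 3 * m c → halfDefect z ∈ compSpan z c := by
        intro c hc
        rcases hz.card_finrank_cases h c with h1 | h1 | h1
        · change 2 * m c ≤ 3 * d c at h1
          omega
        · exact (hz.full_component h h1.1 h1.2).2.1
        · have e1 : d c = 3 := h1.1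
          have e2 : m c = 5 := h1.2
          omega
      have hzero : halfDefect z = 0 := dotProduct_self_eq_zero.1
        (hz.dotProduct_eq_zero_of_ne hcc (hmem c hc) (hmem c' hc'))
      have := card_fracSet_le_of_halfDefect_eq_zero hz.dotProduct_self hzero
      exact Or.inr ⟨(fracSet z).card, by omega, this.1, this.2⟩
    · left
      have hone := sum_ite_le_one (fun c => 5 * d c < 3 * m c) fun c c' hc hc' => by
        by_contra hcc
        exact htwo ⟨c, c', hcc, hc, hc'⟩
      have : 3 * ∑ c, m c ≤ 5 * ∑ c, d c + 3 * ∑ c, (if 5 * d c < 3 * m c then 1 else 0) := by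
        simp only [Finset.mul_sum, ← Finset.sum_add_distrib]
        refine Finset.sum_le_sum fun c _ => ?_
        split_ifs with hc
        · rcases hz.card_finrank_cases h c with h1 | ⟨h1, h2⟩ | h1
          · change 2 * m c ≤ 3 * d c at h1
            omega
          · change m c = 2 ^ d c at h2
            change d c ≤ 2 at h1
            rw [h2]
            generalize d c = e at *
            interval_cases e <;> norm_num
          · have e1 : d c = 3 := h1.1
            have e2 : m c = 5 := h1.2
            omega
        · omega
      omega

end IsCentre

end Degenerate

/-! ### The three upper bounds -/

section Bounds

variable {n : ℕ} {𝓕 : Finset (Finset (Fin n))} {l : ℕ}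

/-- Either the family has a centre, or all kernel vectors of the matrix of excesses have
coordinate sum zero. -/
lemma exists_isCentre_or (𝓕 : Finset (Finset (Fin n))) (l : ℕ) :
    (∃ z, IsCentre 𝓕 l z) ∨
      ∀ α : 𝓕 → ℝ, (∀ a, ∑ b, gap 𝓕 l a b * α b = 0) → ∑ a, α a = 0 := by
  by_cases hker : ∀ α : 𝓕 → ℝ, (∀ a, ∑ b, gap 𝓕 l a b * α b = 0) → ∑ a, α a = 0
  · exact Or.inr hker
  left
  push Not at hker
  obtain ⟨α, hα, hs⟩ := hker
  obtain ⟨s, hsdef⟩ : ∃ s, s = ∑ a, α a := ⟨_, rfl⟩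
  rw [← hsdef] at hs
  have hmem : ∀ a : 𝓕, (s⁻¹ • ∑ b, α b • indVec b.1) ⬝ᵥ indVec a.1 = l := by
    intro a
    have h1 := hα a
    simp only [gap, sub_mul, Finset.sum_sub_distrib, ← Finset.mul_sum, ← hsdef] at h1
    rw [smul_dotProduct, sum_dotProduct, smul_eq_mul, inv_mul_eq_iff_eq_mul₀ hs]
    simp only [smul_dotProduct, indVec_dotProduct, smul_eq_mul]
    rw [mul_comm s, ← sub_eq_zero, ← h1]
    congr 1
    exact Finset.sum_congr rfl fun b _ => by rw [mul_comm, Finset.inter_comm]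
  -- the inner products of this combination with the members determine the one with itself
  refine ⟨s⁻¹ • ∑ b, α b • indVec b.1, ?_, fun F hF => hmem ⟨F, hF⟩⟩
  rw [dotProduct_smul, dotProduct_sum]
  simp only [dotProduct_smul, hmem, smul_eq_mul, ← Finset.sum_mul, ← hsdef]
  rw [← mul_assoc, inv_mul_cancel₀ hs, one_mul]

/-- Integral forms of the bounds; the last two together amount to the one with the minimum. -/
lemma IsAlmostFisher.card_le (h : IsAlmostFisher 2 l 𝓕) (hn : 7 ≤ n) (hl : l ≤ n) :
    𝓕.card ≤ 2 * n - 2 ∧ 2 * 𝓕.card ≤ 3 * n + 9 * l + 3 ∧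
      3 * 𝓕.card ≤ 5 * n + 4 * l + 7 ∧ 9 * 𝓕.card + 4 * l ≤ 19 * n + 21 := by
  rcases exists_isCentre_or 𝓕 l with ⟨z, hz⟩ | hker
  · obtain ⟨D, h1, h2, h3, h4, h5⟩ := hz.card_bounds h
    rcases Nat.eq_zero_or_pos l with rfl | hl0
    · omega
    · have h2 := h2 hl0
      refine ⟨by omega, by omega, ?_, ?_⟩
      · rcases h5 with h5 | ⟨f, h5, h6, h7⟩ <;> omega
      · rcases h5 with h5 | ⟨f, h5, h6, h7⟩ <;> omega
  · have := two_mul_card_le_of_forall_sum_eq_zero h hker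
    omega

lemma IsAlmostFisher.card_le_fisherMax {n k l : ℕ} {𝓕 : Finset (Finset (Fin n))}
    (h : IsAlmostFisher k l 𝓕) : 𝓕.card ≤ fisherMax n k l := by
  classical
  exact Finset.le_sup (f := Finset.card) (Finset.mem_filter.2 ⟨Finset.mem_univ _, h⟩)

lemma exists_card_eq_fisherMax (n k l : ℕ) :
    ∃ 𝓕 : Finset (Finset (Fin n)), IsAlmostFisher k l 𝓕 ∧ 𝓕.card = fisherMax n k l := by
  classical
  obtain ⟨𝓕, h𝓕, heq⟩ := Finset.exists_mem_eq_sup (Finset.univ.filter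
    fun 𝓕 : Finset (Finset (Fin n)) => IsAlmostFisher k l 𝓕)
    ⟨∅, Finset.mem_filter.2 ⟨Finset.mem_univ _, fun F hF => absurd hF (Finset.notMem_empty F)⟩⟩
    Finset.card
  exact ⟨𝓕, (Finset.mem_filter.1 h𝓕).2, heq.symm⟩

lemma fisherMax_two_bounds {n l : ℕ} (hn : 7 ≤ n) (hl : l ≤ n) :
    (fisherMax n 2 l : ℝ) ≤ 2 * (n : ℝ) - 2 ∧
    (fisherMax n 2 l : ℝ) ≤
      (5 * (n : ℝ) + 4 * min (l : ℝ) (((n : ℝ) - (l : ℝ)) / 3) + 7) / 3 ∧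
    (fisherMax n 2 l : ℝ) ≤
      3 / 2 * (n : ℝ) + 3 * (l : ℝ) + 1 / 2 * Real.sqrt ((l : ℝ) * (n : ℝ)) + 90 := by
  obtain ⟨𝓕, h, hcard⟩ := exists_card_eq_fisherMax n 2 l
  obtain ⟨h1, h2, h3, h4⟩ := h.card_le hn hl
  rw [hcard] at h1 h2 h3 h4
  have e1 : (fisherMax n 2 l : ℝ) + 2 ≤ 2 * n := by
    have : fisherMax n 2 l + 2 ≤ 2 * n := by omega
    exact_mod_cast this
  have e2 : 2 * (fisherMax n 2 l : ℝ) ≤ 3 * n + 9 * l + 3 := by exact_mod_cast h2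
  have e3 : 3 * (fisherMax n 2 l : ℝ) ≤ 5 * n + 4 * l + 7 := by exact_mod_cast h3
  have e4 : 9 * (fisherMax n 2 l : ℝ) + 4 * l ≤ 19 * n + 21 := by exact_mod_cast h4
  refine ⟨by linarith, ?_, ?_⟩
  · rcases min_choice (l : ℝ) (((n : ℝ) - (l : ℝ)) / 3) with hmin | hmin <;> rw [hmin] <;> linarith
  · have hl0 : (0 : ℝ) ≤ l := Nat.cast_nonneg l
    have hn0 : (0 : ℝ) ≤ n := Nat.cast_nonneg n
    rcases le_total (9 * (l : ℝ)) n with h9 | h9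
    · have : 3 * (l : ℝ) ≤ Real.sqrt ((l : ℝ) * n) :=
        Real.le_sqrt_of_sq_le (by nlinarith)
      linarith
    · -- here the first bound is the stronger one
      have : (n : ℝ) / 3 ≤ Real.sqrt ((l : ℝ) * n) :=
        Real.le_sqrt_of_sq_le (by nlinarith)
      linarith

end Bounds

/-! ### Families from Hadamard matrices -/

section Hadamard

variable {n : ℕ}

open Classical in
/-- The coordinates where a vector takes the value `1`. -/
noncomputable def onesSet (v : Fin n → ℝ) : Finset (Fin n) :=
  Finset.univ.filter fun i => v i = 1

/-- For `±1` vectors with coordinate sum zero, the inner product determines the intersection of the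
level sets at `1`. -/
lemma four_mul_card_onesSet_inter {u v : Fin n → ℝ} (hu : ∀ i, u i = 1 ∨ u i = -1)
    (hv : ∀ i, v i = 1 ∨ v i = -1) (hu0 : ∑ i, u i = 0) (hv0 : ∑ i, v i = 0) :
    (4 * (onesSet u ∩ onesSet v).card : ℝ) = n + u ⬝ᵥ v := by
  classical
  have hterm : ∀ i, (4 * if i ∈ onesSet u ∩ onesSet v then 1 else 0 : ℝ) =
      1 + u i + v i + u i * v i := by
    intro i
    rcases hu i with h1 | h1 <;> rcases hv i with h2 | h2 <;>
      simp [onesSet, h1, h2] <;> norm_num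
  have hsum : (4 * (onesSet u ∩ onesSet v).card : ℝ) =
      ∑ i, 4 * if i ∈ onesSet u ∩ onesSet v then 1 else 0 := by
    rw [← Finset.mul_sum, Finset.sum_boole, Finset.filter_univ_mem]
  rw [hsum, Finset.sum_congr rfl fun i _ => hterm i]
  simp [Finset.sum_add_distrib, hu0, hv0, dotProduct]

variable {H : Matrix (Fin n) (Fin n) ℝ}

namespace Matrix.IsHadamard

lemma eq_one_or_eq_neg_one (hH : H.IsHadamard) (i j : Fin n) : H i j = 1 ∨ H i j = -1 := by
  have := (Unitary.mem_iff.1 (hH.apply_mem i j)).1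
  rw [star_trivial] at this
  exact mul_self_eq_one_iff.1 this

lemma sum_mul_eq (hH : H.IsHadamard) (j k : Fin n) :
    ∑ i, H i j * H i k = if j = k then (n : ℝ) else 0 := by
  have := congrFun (congrFun hH.conjTranspose_mul j) k
  simpa [Matrix.mul_apply, Matrix.one_apply] using this

end Matrix.IsHadamard

/-- The column `j` of `H`, multiplied by the sign `s`, after the rows of `H` have been rescaled to
turn column `j₀` into the constant `1`. -/
def normalizedColumn (H : Matrix (Fin n) (Fin n) ℝ) (j₀ j : Fin n) (s : ℤˣ) : Fin n → ℝ :=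
  fun i => ((s : ℤ) : ℝ) * (H i j * H i j₀)

lemma normalizedColumn_eq (hH : H.IsHadamard) (j₀ j : Fin n) (s : ℤˣ) (i : Fin n) :
    normalizedColumn H j₀ j s i = 1 ∨ normalizedColumn H j₀ j s i = -1 := by
  rcases Int.units_eq_one_or s with rfl | rfl <;>
    rcases hH.eq_one_or_eq_neg_one i j with h1 | h1 <;>
    rcases hH.eq_one_or_eq_neg_one i j₀ with h2 | h2 <;> simp [normalizedColumn, h1, h2]

lemma sum_normalizedColumn (hH : H.IsHadamard) {j₀ j : Fin n} (hj : j ≠ j₀) (s : ℤˣ) :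
    ∑ i, normalizedColumn H j₀ j s i = 0 := by
  simp only [normalizedColumn, ← Finset.mul_sum, hH.sum_mul_eq, if_neg hj, mul_zero]

lemma dotProduct_normalizedColumn (hH : H.IsHadamard) (j₀ j k : Fin n) (s t : ℤˣ) :
    normalizedColumn H j₀ j s ⬝ᵥ normalizedColumn H j₀ k t =
      ((s * t : ℤˣ) : ℤ) * (if j = k then (n : ℝ) else 0) := by
  rw [← hH.sum_mul_eq, Finset.mul_sum, dotProduct]
  refine Finset.sum_congr rfl fun i _ => ?_
  have h2 : H i j₀ * H i j₀ = 1 := by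
    rcases hH.eq_one_or_eq_neg_one i j₀ with h | h <;> rw [h] <;> norm_num
  simp only [normalizedColumn, Units.val_mul, Int.cast_mul]
  linear_combination ((s : ℤ) : ℝ) * ((t : ℤ) : ℝ) * H i j * H i k * h2

lemma four_mul_card_inter_normalizedColumn (hH : H.IsHadamard) {j₀ j k : Fin n} (hj : j ≠ j₀)
    (hk : k ≠ j₀) (s t : ℤˣ) :
    (4 * (onesSet (normalizedColumn H j₀ j s) ∩ onesSet (normalizedColumn H j₀ k t)).card : ℝ) =
      n + ((s * t : ℤˣ) : ℤ) * (if j = k then (n : ℝ) else 0) := by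
  rw [four_mul_card_onesSet_inter (normalizedColumn_eq hH j₀ j s) (normalizedColumn_eq hH j₀ k t)
    (sum_normalizedColumn hH hj s) (sum_normalizedColumn hH hk t), dotProduct_normalizedColumn hH]

/-- The two level sets of each normalized column other than the constant one form a family of
`2 * n - 2` sets, each of which meets all the others except its complement in `n / 4` elements. -/
lemma Matrix.IsHadamard.four_dvd_and_le_fisherMax (hH : H.IsHadamard) (hn : 3 ≤ n) :
    4 ∣ n ∧ 2 * n - 2 ≤ fisherMax n 2 (n / 4) := by
  classical
  have hn0 : (0 : ℝ) < n := by exact_mod_cast (by omega : 0 < n)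
  let j₀ : Fin n := ⟨0, by omega⟩
  have hdvd : 4 ∣ n := by
    have h := four_mul_card_inter_normalizedColumn hH (j₀ := j₀) (j := ⟨1, by omega⟩)
      (k := ⟨2, by omega⟩) (by simp [j₀]) (by simp [j₀]) 1 1
    rw [if_neg (by simp), mul_zero, add_zero] at h
    exact ⟨_, by exact_mod_cast h.symm⟩
  let F : {j : Fin n // j ≠ j₀} × ℤˣ → Finset (Fin n) :=
    fun p => onesSet (normalizedColumn H j₀ p.1 p.2)
  have hF : ∀ p q, (4 * (F p ∩ F q).card : ℝ) =
      n + ((p.2 * q.2 : ℤˣ) : ℤ) * (if (p.1 : Fin n) = q.1 then (n : ℝ) else 0) :=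
    fun p q => four_mul_card_inter_normalizedColumn hH p.1.2 q.1.2 p.2 q.2
  have hinj : Function.Injective F := by
    intro p q hpq
    have h1 := hF p p
    have h2 := hF p q
    rw [← hpq, h1] at h2
    rw [if_pos rfl, Int.units_mul_self] at h2
    have hne : (p.1 : Fin n) = q.1 := by
      by_contra hne
      rw [if_neg hne] at h2
      simp at h2
      omega
    refine Prod.ext (Subtype.ext hne) ?_
    rw [if_pos hne] at h2
    rcases Int.units_eq_one_or p.2 with h | h <;> rcases Int.units_eq_one_or q.2 with h' | h' <;>
      rw [h, h'] at h2 ⊢ <;> norm_num at h2 <;> linarith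
  refine ⟨hdvd, ?_⟩
  have hfisher : IsAlmostFisher 2 (n / 4) (Finset.univ.image F) := by
    intro A hA
    obtain ⟨p, -, rfl⟩ := Finset.mem_image.1 hA
    have hsub : ((Finset.univ.image F).filter fun F' => F' ≠ F p ∧ (F p ∩ F').card ≠ n / 4) ⊆
        {F (p.1, -p.2)} := by
      intro B hB
      obtain ⟨hB, hne, hcard⟩ := Finset.mem_filter.1 hB
      obtain ⟨q, -, rfl⟩ := Finset.mem_image.1 hB
      have hpq : (p.1 : Fin n) = q.1 := by
        by_contra hpq
        have h := hF p q
        rw [if_neg hpq, mul_zero, add_zero] at h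
        have : 4 * (F p ∩ F q).card = n := by exact_mod_cast h
        omega
      have hsign : q.2 ≠ p.2 := fun h => hne (congrArg F (Prod.ext (Subtype.ext hpq.symm) h))
      have hq : q = (p.1, -p.2) := Prod.ext (Subtype.ext hpq.symm) (by
        rcases Int.units_eq_one_or p.2 with h | h <;>
          rcases Int.units_eq_one_or q.2 with h' | h' <;>
          rw [h, h'] at hsign <;> simp [h, h'] at hsign ⊢)
      rw [hq]
      exact Finset.mem_singleton_self _
    exact (Finset.card_le_card hsub).trans (by simp)
  have hcard : (Finset.univ.image F).card = 2 * n - 2 := by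
    rw [Finset.card_image_of_injective _ hinj, Finset.card_univ, Fintype.card_prod,
      Fintype.card_units_int, Fintype.card_subtype_compl, Fintype.card_fin,
      Fintype.card_subtype_eq]
    omega
  exact hcard ▸ hfisher.card_le_fisherMax

lemma Matrix.IsHadamard.fisherMax_eq (hH : H.IsHadamard) (hn : 7 ≤ n) :
    4 ∣ n ∧ (fisherMax n 2 (n / 4) : ℝ) = 2 * (n : ℝ) - 2 := by
  obtain ⟨h4, hle⟩ := hH.four_dvd_and_le_fisherMax (by omega)
  refine ⟨h4, le_antisymm (fisherMax_two_bounds hn (Nat.div_le_self n 4)).1 ?_⟩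
  have : 2 * n ≤ fisherMax n 2 (n / 4) + 2 := by omega
  have : 2 * (n : ℝ) ≤ fisherMax n 2 (n / 4) + 2 := by exact_mod_cast this
  linarith

open scoped Kronecker in
/-- Sylvester's construction of Hadamard matrices. -/
lemma exists_isHadamard_two_pow (k : ℕ) :
    ∃ H : Matrix (Fin (2 ^ k)) (Fin (2 ^ k)) ℝ, H.IsHadamard := by
  induction k with
  | zero =>
    change ∃ H : Matrix (Fin 1) (Fin 1) ℝ, H.IsHadamard
    refine ⟨1, fun i j => ?_, by simp, by simp⟩
    rw [Subsingleton.elim i j, Matrix.one_apply_eq]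
    exact one_mem _
  | succ k ih =>
    obtain ⟨A, hA⟩ := ih
    let B : Matrix (Fin 2) (Fin 2) ℝ := !![1, 1; 1, -1]
    have hB : B.IsHadamard := by
      refine ⟨fun i j => ?_, ?_, ?_⟩
      · fin_cases i <;> fin_cases j <;> simp [B, Unitary.mem_iff]
      · ext i j
        fin_cases i <;> fin_cases j <;> simp [B, Matrix.mul_apply] <;> norm_num
      · ext i j
        fin_cases i <;> fin_cases j <;> simp [B, Matrix.mul_apply] <;> norm_num
    have e : Fin (2 ^ k) × Fin 2 ≃ Fin (2 ^ (k + 1)) :=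
      Fintype.equivFinOfCardEq (by simp [pow_succ])
    exact ⟨_, (hA.kronecker hB).reindex e e⟩

end Hadamard

/-! ### The asymptotic form -/

lemma exists_tendsto_zero_of_isLittleO {l : ℕ → ℕ}
    (hl : Asymptotics.IsLittleO Filter.atTop (fun n : ℕ => (l n : ℝ)) (fun n : ℕ => (n : ℝ))) :
    ∃ ε : ℕ → ℝ, Filter.Tendsto ε Filter.atTop (nhds 0) ∧
      ∀ᶠ n : ℕ in Filter.atTop, (fisherMax n 2 (l n) : ℝ) ≤ (3 / 2 + ε n) * (n : ℝ) := by
  have h0 : Filter.Tendsto (fun n : ℕ => (l n : ℝ) / n) Filter.atTop (nhds 0) :=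
    hl.tendsto_div_nhds_zero
  have h1 : Filter.Tendsto (fun n : ℕ => Real.sqrt ((l n : ℝ) / n)) Filter.atTop (nhds 0) := by
    have h := (Real.continuous_sqrt.tendsto 0).comp h0
    rwa [Real.sqrt_zero] at h
  refine ⟨fun n => 3 * ((l n : ℝ) / n) + 1 / 2 * Real.sqrt ((l n : ℝ) / n) + 90 / n, ?_, ?_⟩
  · have h := ((h0.const_mul 3).add (h1.const_mul (1 / 2))).add
      (tendsto_const_div_atTop_nhds_zero_nat (90 : ℝ))
    rwa [mul_zero, mul_zero, add_zero, add_zero] at h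
  · filter_upwards [hl.bound one_pos, Filter.eventually_ge_atTop 7] with n hln hn
    have hln : l n ≤ n := by simpa using hln
    have hn0 : (0 : ℝ) < n := by exact_mod_cast (by omega : 0 < n)
    have hsqrt : Real.sqrt ((l n : ℝ) * n) = Real.sqrt ((l n : ℝ) / n) * n := by
      rw [← Real.sqrt_sq hn0.le, ← Real.sqrt_mul (by positivity), Real.sqrt_sq hn0.le]
      congr 1
      field_simp
    refine (fisherMax_two_bounds hn hln).2.2.trans (le_of_eq ?_)
    rw [hsqrt]
    field_simp
    ring

theorem theorem1p6 :
    -- the bounds for all sufficiently large `n`, uniformly in `0 ≤ l ≤ n`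
    (∃ N : ℕ, ∀ n : ℕ, N ≤ n → ∀ l : ℕ, l ≤ n →
      (fisherMax n 2 l : ℝ) ≤ 2 * (n : ℝ) - 2 ∧
      (fisherMax n 2 l : ℝ) ≤
        (5 * (n : ℝ) + 4 * min (l : ℝ) (((n : ℝ) - (l : ℝ)) / 3) + 7) / 3 ∧
      (fisherMax n 2 l : ℝ) ≤
        3 / 2 * (n : ℝ) + 3 * (l : ℝ) + 1 / 2 * Real.sqrt ((l : ℝ) * (n : ℝ)) + 90) ∧
    -- the asymptotic bound when `l = o(n)`
    (∀ l : ℕ → ℕ,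
      Asymptotics.IsLittleO Filter.atTop (fun n : ℕ => (l n : ℝ)) (fun n : ℕ => (n : ℝ)) →
      ∃ ε : ℕ → ℝ, Filter.Tendsto ε Filter.atTop (nhds 0) ∧
        ∀ᶠ n : ℕ in Filter.atTop, (fisherMax n 2 (l n) : ℝ) ≤ (3 / 2 + ε n) * (n : ℝ)) ∧
    -- tightness of the first bound: it is attained with `l = n / 4` at every large order `n` of a
    -- Hadamard matrix, and for infinitely many `n`
    (∃ N : ℕ, ∀ n : ℕ, N ≤ n → ∀ H : Matrix (Fin n) (Fin n) ℝ, H.IsHadamard →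
      4 ∣ n ∧ (fisherMax n 2 (n / 4) : ℝ) = 2 * (n : ℝ) - 2) ∧
    (∃ᶠ n : ℕ in Filter.atTop, 4 ∣ n ∧ (fisherMax n 2 (n / 4) : ℝ) = 2 * (n : ℝ) - 2) := by

  refine ⟨⟨7, fun n hn l hl => fisherMax_two_bounds hn hl⟩,
    fun l hl => exists_tendsto_zero_of_isLittleO hl,
    ⟨7, fun n hn H hH => hH.fisherMax_eq hn⟩, Filter.frequently_atTop.2 fun N => ?_⟩
  obtain ⟨H, hH⟩ := exists_isHadamard_two_pow (N + 3)
  have hN : N < 2 ^ N := Nat.lt_two_pow_self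
  have h8 : 2 ^ (N + 3) = 8 * 2 ^ N := by ring
  exact ⟨2 ^ (N + 3), by omega, hH.fisherMax_eq (by omega)⟩
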